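/- For a finite simple graph $G$ and an integer $r$, let $T_r(G)$ be the number of orientations of $G$ in which every copy of $K_r$ is transitively oriented, and let $T_r(n,p)=T_r(G(n,p))$, where $G(n,p)$ is the binomial random graph on $n$ vertices with edge probability $p$. Let $r\ge 4$ be a fixed integer. (a) There is a constant $C>0$, depending only on $r$, such that for every function $p=p(n)\in[0,1]$ with $p>n^{-2/(r+2)}$ for all sufficiently large $n$, we have \[T_r(n,p)\le \exp\left(\frac{C\,n(\log n)^2}{p}\right)\] with high probability, that is, with probability tending to $1$ as $n\to\infty$. (b) There is a constant $C>0$, depending only on $r$, such that for every function $p=p(n)\in[0,1]$ with $0<p\le n^{-2/(r+2)}$ for all sufficiently large $n$, we have \[T_r(n,p)\le \exp\left(\frac{C\,n^{4-r}(\log n)^2}{p^{\binom r2-2}}\right)\] with probability tending to $1$ as $n\to\infty$. -/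

import Mathlib

/-- `D` is an orientation of the simple graph `G`: every arc of `D` runs along an edge of `G`,
and every edge of `G` carries exactly one of its two possible arcs. -/
def Digraph.IsOrientationOf {V : Type*} (D : Digraph V) (G : SimpleGraph V) : Prop :=
  (∀ u v : V, D.Adj u v → G.Adj u v) ∧
    ∀ u v : V, G.Adj u v → Xor (D.Adj u v) (D.Adj v u)

/-- The arcs of `D` inside the vertex set `K` form a transitive relation. When `K` is a clique of
a graph of which `D` is an orientation, this says that the tournament `D[K]` is transitive. -/
def Digraph.IsTransitiveOn {V : Type*} (D : Digraph V) (K : Finset V) : Prop :=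
  ∀ u ∈ K, ∀ v ∈ K, ∀ w ∈ K, D.Adj u v → D.Adj v w → D.Adj u w

/-- The orientations of `G` in which every copy of `K_r` is transitively oriented. -/
def SimpleGraph.transitiveOrientations {V : Type*} (G : SimpleGraph V) (r : ℕ) :
    Set (Digraph V) :=
  {D | D.IsOrientationOf G ∧ ∀ K : Finset V, G.IsNClique r K → D.IsTransitiveOn K}

/-- The number of orientations of `G` in which every copy of `K_r` is transitively oriented. Its
value at the random graph `G(n, p)` is the random variable `T_r(n, p)`. -/
noncomputable def SimpleGraph.numTransitiveOrientations {V : Type*} (G : SimpleGraph V) (r : ℕ) :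
    ℕ :=
  (G.transitiveOrientations r).ncard

/-! Write r = t + 3, and let q be the minimum of 1 and n^t p^(t(t+5)/2), the order of the expected
number of extensions of a triangle to a K_r (`extensionRate`). Both bounds are cases of T_r ≤ exp(C
n (log n)² / (p q)), since p = n^(-2/(r+2)) is exactly where the uncapped value equals 1.

Compression (`SimpleGraph.NeighborsLinked.numTransitiveOrientations_le`). By transitivity, the
out-neighbours of v among the earlier vertices are closed under those arcs u → w for which u, w, v
lie in a common K_r. A minimal generating set for this closure contains no such arc, hence no two
vertices in a common K_r with v. If any k neighbours of a vertex include such a pair, the generating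
set has at most k elements. The orientation is recovered vertex by vertex from these sets, which
leaves at most (n+1)^(kn) orientations.

Linking (`binomialRandom_not_neighborsLinked_le`). Suppose n p² q is at least a large multiple of
(log n)², and take k = 2s with s of order log n / (p q). Fix v and 2s prospective neighbours, split
into halves. Janson's inequality for K_r minus two edges at the root, with one marked vertex in each
half, bounds the failure probability by exp(-4 s log n), because every sub-pattern with an edge has
expectation at least a large multiple of s log n. This beats the union bound over n^(2s+1) choices.

Otherwise n p² q = O((log n)²). Then p n² is already O(n (log n)² / (p q)), and Markov's inequality
applied to the trivial bound 2^e(G) suffices. -/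

/-- The probability that the random subset of a finite type containing each element `e`
independently with probability `p e` is equal to `S`. -/
noncomputable def bernWeight {α : Type*} [Fintype α] [DecidableEq α] (p : α → ℝ)
    (S : Finset α) : ℝ :=
  (∏ e ∈ S, p e) * ∏ e ∈ Sᶜ, (1 - p e)

/-- The expectation of `f` at the random subset containing each element `e` independently with
probability `p e`. -/
noncomputable def bernExp {α : Type*} [Fintype α] [DecidableEq α] (p : α → ℝ)
    (f : Finset α → ℝ) : ℝ :=
  ∑ S, bernWeight p S * f S

/-! ### Damped products for Janson's inequality -/

lemma subset_indicator_monotone {α : Type*} [DecidableEq α] (Q : Finset α) :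
    Monotone (fun S : Finset α => if Q ⊆ S then (1 : ℝ) else 0) := by
  intro S T hST
  by_cases h : Q ⊆ S
  · simp [h, h.trans hST]
  · simp only [h, if_false]; split_ifs <;> norm_num

lemma jansonFactor_mem {α : Type*} [DecidableEq α] {θ : ℝ} (hθ0 : 0 ≤ θ) (hθ1 : θ ≤ 1) (R S : Finset α) :
    0 ≤ 1 - θ * (if R ⊆ S then 1 else 0) ∧ 1 - θ * (if R ⊆ S then 1 else 0) ≤ 1 := by
  split_ifs <;> constructor <;> linarith

section JansonProd

variable {α ι : Type*} [DecidableEq α] {I : Finset ι} {Q : ι → Finset α} {θ : ℝ}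

/-- The damped counting product of **Janson's inequality**: for `θ ≤ 1` it is at least the
indicator of the event that no `Q i` is contained in the random set. -/
noncomputable def jansonProd (I : Finset ι) (Q : ι → Finset α) (θ : ℝ)
    (S : Finset α) : ℝ :=
  ∏ i ∈ I, (1 - θ * if Q i ⊆ S then 1 else 0)

lemma jansonProd_nonneg (hθ0 : 0 ≤ θ) (hθ1 : θ ≤ 1) (S : Finset α) : 0 ≤ jansonProd I Q θ S :=
  Finset.prod_nonneg fun i _ => (jansonFactor_mem hθ0 hθ1 (Q i) S).1

lemma jansonProd_le_one (hθ0 : 0 ≤ θ) (hθ1 : θ ≤ 1) (S : Finset α) : jansonProd I Q θ S ≤ 1 :=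
  Finset.prod_le_one (fun i _ => (jansonFactor_mem hθ0 hθ1 (Q i) S).1)
    fun i _ => (jansonFactor_mem hθ0 hθ1 (Q i) S).2

lemma jansonProd_antitone (hθ0 : 0 ≤ θ) (hθ1 : θ ≤ 1) : Antitone (jansonProd I Q θ) := by
  intro S T hST
  refine Finset.prod_le_prod (fun i _ => (jansonFactor_mem hθ0 hθ1 (Q i) T).1) fun i _ => ?_
  have := mul_le_mul_of_nonneg_left (subset_indicator_monotone (Q i) hST) hθ0
  linarith

lemma one_sub_sum_le_jansonProd (hθ0 : 0 ≤ θ) (hθ1 : θ ≤ 1) (S : Finset α) :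
    1 - θ * ∑ i ∈ I, (if Q i ⊆ S then 1 else 0) ≤ jansonProd I Q θ S := by
  classical
  induction I using Finset.induction_on with
  | empty => simp [jansonProd]
  | insert i I hi ih =>
    have h1 := jansonProd_le_one (I := I) (Q := Q) hθ0 hθ1 S
    rw [jansonProd, Finset.prod_insert hi, Finset.sum_insert hi]
    change _ ≤ _ * jansonProd I Q θ S
    have h2 : θ * (if Q i ⊆ S then 1 else 0) * jansonProd I Q θ S ≤
        θ * (if Q i ⊆ S then 1 else 0) :=
      mul_le_of_le_one_right (mul_nonneg hθ0 (by split_ifs <;> norm_num)) h1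
    linarith

end JansonProd

/-! ### Bernoulli random subsets: the Harris and Janson inequalities -/

section BernoulliSubset

variable {α : Type*} [Fintype α] [DecidableEq α] {p : α → ℝ}

lemma bernWeight_nonneg (h0 : ∀ e, 0 ≤ p e) (h1 : ∀ e, p e ≤ 1) (S : Finset α) :
    0 ≤ bernWeight p S :=
  mul_nonneg (Finset.prod_nonneg fun e _ => h0 e)
    (Finset.prod_nonneg fun e _ => sub_nonneg.2 (h1 e))

lemma sum_bernWeight (p : α → ℝ) : ∑ S, bernWeight p S = 1 := by
  have := Fintype.prod_add p (fun e => 1 - p e)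
  simp only [add_sub_cancel, Finset.prod_const_one] at this
  exact this.symm

lemma bernExp_one (p : α → ℝ) : bernExp p (fun _ => 1) = 1 := by
  simp [bernExp, sum_bernWeight]

lemma bernExp_mono (h0 : ∀ e, 0 ≤ p e) (h1 : ∀ e, p e ≤ 1) {f g : Finset α → ℝ}
    (h : ∀ S, f S ≤ g S) : bernExp p f ≤ bernExp p g :=
  Finset.sum_le_sum fun S _ => mul_le_mul_of_nonneg_left (h S) (bernWeight_nonneg h0 h1 S)

lemma bernExp_nonneg (h0 : ∀ e, 0 ≤ p e) (h1 : ∀ e, p e ≤ 1) {f : Finset α → ℝ}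
    (h : ∀ S, 0 ≤ f S) : 0 ≤ bernExp p f :=
  Finset.sum_nonneg fun S _ => mul_nonneg (bernWeight_nonneg h0 h1 S) (h S)

lemma bernExp_sub (p : α → ℝ) (f g : Finset α → ℝ) :
    bernExp p (fun S => f S - g S) = bernExp p f - bernExp p g := by
  simp [bernExp, mul_sub, Finset.sum_sub_distrib]

lemma bernExp_const_mul (p : α → ℝ) (c : ℝ) (f : Finset α → ℝ) :
    bernExp p (fun S => c * f S) = c * bernExp p f := by
  simp only [bernExp, Finset.mul_sum]
  exact Finset.sum_congr rfl fun S _ => by ring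

lemma bernExp_sum {ι : Type*} (p : α → ℝ) (I : Finset ι) (f : ι → Finset α → ℝ) :
    bernExp p (fun S => ∑ i ∈ I, f i S) = ∑ i ∈ I, bernExp p (f i) := by
  simp only [bernExp, Finset.mul_sum]
  exact Finset.sum_comm

lemma bernExp_two_pow_card (p : α → ℝ) :
    bernExp p (fun S => 2 ^ S.card) = ∏ e, (1 + p e) := by
  have h := Fintype.prod_add (fun e => p e * 2) (fun e => 1 - p e)
  have h2 : ∀ e, p e * 2 + (1 - p e) = 1 + p e := fun e => by ring
  simp only [h2, Finset.prod_mul_distrib, Finset.prod_const] at h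
  rw [h, bernExp]
  exact Finset.sum_congr rfl fun S _ => by rw [bernWeight]; ring

lemma bernWeight_insert {e : α} {S : Finset α} (he : e ∉ S) :
    (1 - p e) * bernWeight p (insert e S) = p e * bernWeight p S := by
  have h : Sᶜ = insert e (insert e S)ᶜ := by
    ext x; by_cases hx : x = e <;> simp [hx, he]
  rw [bernWeight, bernWeight, h, Finset.prod_insert he, Finset.prod_insert (by simp)]
  ring

lemma sum_finset_eq_sum_powerset_erase (e : α) (F : Finset α → ℝ) :
    ∑ S, F S = ∑ S ∈ (Finset.univ.erase e).powerset, (F S + F (insert e S)) := by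
  rw [← Finset.powerset_univ, ← Finset.insert_erase (Finset.mem_univ e),
    Finset.sum_powerset_insert (Finset.notMem_erase e _), Finset.sum_add_distrib]
  simp

lemma bernExp_mem_mul (p : α → ℝ) (e : α) (f : Finset α → ℝ) :
    bernExp p (fun S => (if e ∈ S then 1 else 0) * f S) =
      p e * bernExp p (fun S => f (insert e S)) := by
  rw [bernExp, bernExp, sum_finset_eq_sum_powerset_erase e, sum_finset_eq_sum_powerset_erase e,
    Finset.mul_sum]
  refine Finset.sum_congr rfl fun S hS => ?_
  have he : e ∉ S := fun h => by simpa using Finset.mem_powerset.1 hS h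
  have := bernWeight_insert (p := p) he
  simp only [he, if_false, Finset.mem_insert_self, if_true, Finset.insert_idem]
  linear_combination f (insert e S) * this

/-- Conditioning on Q ⊆ S amounts to adding Q to S, by independence of the elements. -/
lemma bernExp_subset_mul (p : α → ℝ) (Q : Finset α) (f : Finset α → ℝ) :
    bernExp p (fun S => (if Q ⊆ S then 1 else 0) * f S) =
      (∏ e ∈ Q, p e) * bernExp p (fun S => f (S ∪ Q)) := by
  induction Q using Finset.induction_on generalizing f with
  | empty => simp
  | insert e Q he ih =>
    have h : ∀ S : Finset α, (if insert e Q ⊆ S then (1 : ℝ) else 0) * f S =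
        (if Q ⊆ S then 1 else 0) * ((if e ∈ S then 1 else 0) * f S) := fun S => by
      by_cases h1 : e ∈ S <;> by_cases h2 : Q ⊆ S <;> simp [Finset.insert_subset_iff, h1, h2]
    simp only [h]
    rw [ih]
    have h2 : ∀ S : Finset α, (if e ∈ S ∪ Q then (1 : ℝ) else 0) * f (S ∪ Q) =
        (if e ∈ S then 1 else 0) * f (S ∪ Q) := fun S => by simp [he]
    simp only [h2]
    rw [bernExp_mem_mul p e (fun S => f (S ∪ Q)), Finset.prod_insert he]
    have h3 : ∀ S : Finset α, insert e S ∪ Q = S ∪ insert e Q := fun S => by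
      ext; simp
    simp only [h3]
    ring

lemma bernExp_subset (p : α → ℝ) (Q : Finset α) :
    bernExp p (fun S => if Q ⊆ S then 1 else 0) = ∏ e ∈ Q, p e := by
  simpa [bernExp_one] using bernExp_subset_mul p Q (fun _ => 1)

/-- **Harris' inequality** for two increasing functions of a random subset. -/
lemma bernExp_mul_le (h0 : ∀ e, 0 ≤ p e) (h1 : ∀ e, p e ≤ 1) {f g : Finset α → ℝ}
    (hf0 : 0 ≤ f) (hg0 : 0 ≤ g) (hf : Monotone f) (hg : Monotone g) :
    bernExp p f * bernExp p g ≤ bernExp p (fun S => f S * g S) := by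
  have h := fkg (μ := bernWeight p) (f := f) (g := g) (fun S => bernWeight_nonneg h0 h1 S)
    hf0 hg0 hf hg ?_
  · rwa [sum_bernWeight, one_mul] at h
  -- Product weights are log-modular, so the lattice condition holds with equality.
  · intro A B
    have e1 := Finset.prod_union_inter (s₁ := A) (s₂ := B) (f := p)
    have e2 := Finset.prod_union_inter (s₁ := Aᶜ) (s₂ := Bᶜ) (f := fun e => 1 - p e)
    apply le_of_eq
    simp only [bernWeight, Finset.inf_eq_inter, Finset.sup_eq_union, Finset.compl_inter,
      Finset.compl_union]
    linear_combination (-(∏ e ∈ Aᶜ, (1 - p e)) * ∏ e ∈ Bᶜ, (1 - p e)) * e1 -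
      ((∏ e ∈ A ∪ B, p e) * ∏ e ∈ A ∩ B, p e) * e2

/-- **Harris' inequality** for an increasing and a decreasing function of a random subset. -/
lemma bernExp_mul_le_of_antitone (h0 : ∀ e, 0 ≤ p e) (h1 : ∀ e, p e ≤ 1) {f g : Finset α → ℝ}
    (hf0 : 0 ≤ f) (hg1 : g ≤ 1) (hf : Monotone f) (hg : Antitone g) :
    bernExp p (fun S => f S * g S) ≤ bernExp p f * bernExp p g := by
  have h := bernExp_mul_le h0 h1 (f := f) (g := fun S => 1 - g S) hf0
    (fun S => sub_nonneg.2 (hg1 S)) hf (fun S T hST => sub_le_sub_left (hg hST) 1)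
  have e1 : ∀ S, f S * (1 - g S) = f S - f S * g S := fun S => by ring
  simp only [e1] at h
  rw [bernExp_sub, bernExp_sub, bernExp_one] at h
  linarith

section Janson

variable {ι : Type*} {θ : ℝ}

/-- Adding one set at a time multiplies the expectation by at most 1 - θx, where x is a lower bound
for the probability of the new set under the measure tilted by the product so far. The damping θ
stays free, so that the quadratic term can be balanced against the linear one. -/
lemma bernExp_jansonProd_le [DecidableEq ι] (h0 : ∀ e, 0 ≤ p e) (h1 : ∀ e, p e ≤ 1)
    (I : Finset ι) (Q : ι → Finset α) (hθ0 : 0 ≤ θ) (hθ1 : θ ≤ 1) :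
    bernExp p (jansonProd I Q θ) ≤
      Real.exp (-θ * ∑ i ∈ I, ∏ e ∈ Q i, p e + θ ^ 2 *
        ∑ i ∈ I, ∑ j ∈ I with ¬ Disjoint (Q i) (Q j), ∏ e ∈ Q i ∪ Q j, p e) := by
  induction I using Finset.induction_on with
  | empty => exact le_of_eq (by simp [bernExp, jansonProd, sum_bernWeight])
  | insert k I hk ih =>
    set I₁ := I.filter (fun j => ¬ Disjoint (Q k) (Q j)) with hI₁
    set I₂ := I.filter (fun j => ¬ ¬ Disjoint (Q k) (Q j)) with hI₂
    set x : ℝ := ∏ e ∈ Q k, p e - θ * ∑ j ∈ I₁, ∏ e ∈ Q k ∪ Q j, p e with hx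
    have hsplit : ∀ S, jansonProd I Q θ S = jansonProd I₁ Q θ S * jansonProd I₂ Q θ S := fun S =>
      (Finset.prod_filter_mul_prod_filter_not I _ _).symm
    have hI0 : 0 ≤ bernExp p (jansonProd I Q θ) :=
      bernExp_nonneg h0 h1 (jansonProd_nonneg hθ0 hθ1)
    have hle : bernExp p (jansonProd I Q θ) ≤ bernExp p (jansonProd I₂ Q θ) :=
      bernExp_mono h0 h1 fun S => by
        rw [hsplit]
        exact mul_le_of_le_one_left (jansonProd_nonneg hθ0 hθ1 S) (jansonProd_le_one hθ0 hθ1 S)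
    have hindep : ∀ S, jansonProd I₂ Q θ (S ∪ Q k) = jansonProd I₂ Q θ S := fun S => by
      refine Finset.prod_congr rfl fun j hj => ?_
      have hd : Disjoint (Q j) (Q k) := by
        have := (Finset.mem_filter.1 hj).2
        exact (not_not.1 this).symm
      have : Q j ⊆ S ∪ Q k ↔ Q j ⊆ S :=
        ⟨fun h => hd.left_le_of_le_sup_right h, fun h => h.trans Finset.subset_union_left⟩
      simp only [this]
    -- The factors in `I₁` are bounded below by one minus a sum. Those in `I₂` are independent of Q
    -- k and factor out exactly, and Harris' inequality bounds the subtracted terms.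
    have hkey : x * bernExp p (jansonProd I₂ Q θ) ≤
        bernExp p (fun S => (if Q k ⊆ S then 1 else 0) * jansonProd I Q θ S) := by
      have hA : bernExp p (fun S => (if Q k ⊆ S then 1 else 0) * jansonProd I₂ Q θ S) =
          (∏ e ∈ Q k, p e) * bernExp p (jansonProd I₂ Q θ) := by
        rw [bernExp_subset_mul]; simp only [hindep]
      have hB : ∀ j, bernExp p (fun S => (if Q k ∪ Q j ⊆ S then 1 else 0) * jansonProd I₂ Q θ S) ≤
          (∏ e ∈ Q k ∪ Q j, p e) * bernExp p (jansonProd I₂ Q θ) := fun j => by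
        have := bernExp_mul_le_of_antitone h0 h1 (f := fun S => if Q k ∪ Q j ⊆ S then (1 : ℝ) else 0)
          (g := jansonProd I₂ Q θ) (fun S => by dsimp only; split_ifs <;> norm_num)
          (jansonProd_le_one hθ0 hθ1) (subset_indicator_monotone _) (jansonProd_antitone hθ0 hθ1)
        rwa [bernExp_subset] at this
      calc x * bernExp p (jansonProd I₂ Q θ)
          = (∏ e ∈ Q k, p e) * bernExp p (jansonProd I₂ Q θ) - θ * ∑ j ∈ I₁,
              (∏ e ∈ Q k ∪ Q j, p e) * bernExp p (jansonProd I₂ Q θ) := by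
            rw [hx, ← Finset.sum_mul]; ring
        _ ≤ bernExp p (fun S => (if Q k ⊆ S then 1 else 0) * jansonProd I₂ Q θ S) - θ * ∑ j ∈ I₁,
              bernExp p (fun S => (if Q k ∪ Q j ⊆ S then 1 else 0) * jansonProd I₂ Q θ S) := by
            rw [hA]
            have := mul_le_mul_of_nonneg_left (Finset.sum_le_sum fun j (_ : j ∈ I₁) => hB j) hθ0
            linarith
        _ = bernExp p (fun S => (if Q k ⊆ S then 1 else 0) * ((1 - θ * ∑ j ∈ I₁,
              (if Q j ⊆ S then 1 else 0)) * jansonProd I₂ Q θ S)) := by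
            rw [← bernExp_sum, ← bernExp_const_mul, ← bernExp_sub]
            congr 1; funext S
            rw [← Finset.sum_mul]
            by_cases hS : Q k ⊆ S <;> simp [Finset.union_subset_iff, hS]
            ring
        _ ≤ _ := by
            refine bernExp_mono h0 h1 fun S => ?_
            rw [hsplit]
            refine mul_le_mul_of_nonneg_left (mul_le_mul_of_nonneg_right
              (one_sub_sum_le_jansonProd hθ0 hθ1 S) (jansonProd_nonneg hθ0 hθ1 S)) ?_
            split_ifs <;> norm_num
    have hkey2 : x * bernExp p (jansonProd I Q θ) ≤
        bernExp p (fun S => (if Q k ⊆ S then 1 else 0) * jansonProd I Q θ S) := by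
      -- `hle` helps only when x ≥ 0; for x < 0 the left side is nonpositive.
      rcases le_or_gt 0 x with h | h
      · exact (mul_le_mul_of_nonneg_left hle h).trans hkey
      · refine (mul_nonpos_of_nonpos_of_nonneg h.le hI0).trans (bernExp_nonneg h0 h1 fun S => ?_)
        exact mul_nonneg (by split_ifs <;> norm_num) (jansonProd_nonneg hθ0 hθ1 S)
    have hstep : bernExp p (jansonProd (insert k I) Q θ) =
        bernExp p (jansonProd I Q θ) - θ *
          bernExp p (fun S => (if Q k ⊆ S then 1 else 0) * jansonProd I Q θ S) := by
      rw [← bernExp_const_mul, ← bernExp_sub]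
      congr 1; funext S
      rw [jansonProd, Finset.prod_insert hk, jansonProd]; ring
    -- The row of k is kept; the pairs (i, k) with i in I and the pair (k, k) are discarded.
    have hmono : ∑ i ∈ I, ∑ j ∈ I with ¬ Disjoint (Q i) (Q j), ∏ e ∈ Q i ∪ Q j, p e +
        ∑ j ∈ I₁, ∏ e ∈ Q k ∪ Q j, p e ≤
        ∑ i ∈ insert k I, ∑ j ∈ insert k I with ¬ Disjoint (Q i) (Q j), ∏ e ∈ Q i ∪ Q j, p e := by
      rw [Finset.sum_insert hk, add_comm]
      have hp : ∀ R : Finset α, 0 ≤ ∏ e ∈ R, p e := fun R => Finset.prod_nonneg fun e _ => h0 e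
      refine add_le_add ?_ (Finset.sum_le_sum fun i _ => ?_) <;>
      exact Finset.sum_le_sum_of_subset_of_nonneg
        (Finset.filter_subset_filter _ (Finset.subset_insert k I)) fun j _ _ => hp _
    calc bernExp p (jansonProd (insert k I) Q θ)
        ≤ bernExp p (jansonProd I Q θ) * (1 - θ * x) := by
          rw [hstep]; have := mul_le_mul_of_nonneg_left hkey2 hθ0; linarith
      _ ≤ bernExp p (jansonProd I Q θ) * Real.exp (-(θ * x)) :=
          mul_le_mul_of_nonneg_left (Real.one_sub_le_exp_neg _) hI0
      _ ≤ _ := (mul_le_mul_of_nonneg_right ih (Real.exp_nonneg _)).trans (by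
          rw [← Real.exp_add, Real.exp_le_exp, Finset.sum_insert hk]
          have := mul_le_mul_of_nonneg_left hmono (sq_nonneg θ)
          rw [hx]
          linarith)

end Janson

end BernoulliSubset

/-! ### Small generating sets -/

section SmallGenerators

variable {V : Type*}

/-- A generating set of least cardinality works: if R a b held for distinct members, b could be
dropped, since a reaches all that b reaches. -/
lemma exists_independent_generators [DecidableEq V] (R : V → V → Prop) (O : Finset V) :
    ∃ B ⊆ O, (∀ u ∈ O, ∃ b ∈ B, Relation.ReflTransGen R b u) ∧
      ∀ a ∈ B, ∀ b ∈ B, a ≠ b → ¬ R a b := by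
  classical
  obtain ⟨B, hB, hmin⟩ := Finset.exists_min_image
    (O.powerset.filter fun B => ∀ u ∈ O, ∃ b ∈ B, Relation.ReflTransGen R b u) Finset.card
    ⟨O, by simpa using fun u hu => ⟨u, hu, Relation.ReflTransGen.refl⟩⟩
  simp only [Finset.mem_filter, Finset.mem_powerset] at hB hmin
  refine ⟨B, hB.1, hB.2, fun a ha b hb hab hR => ?_⟩
  have h := hmin (B.erase b) ⟨(Finset.erase_subset b B).trans hB.1, fun u hu => ?_⟩
  · exact absurd h (not_le.2 (Finset.card_erase_lt_of_mem hb))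
  · obtain ⟨c, hc, hcu⟩ := hB.2 u hu
    by_cases hcb : c = b
    · exact ⟨a, Finset.mem_erase.2 ⟨hab, ha⟩, Relation.ReflTransGen.head hR (hcb ▸ hcu)⟩
    · exact ⟨c, Finset.mem_erase.2 ⟨hcb, hc⟩, hcu⟩

lemma card_filter_card_le [Fintype V] [DecidableEq V] (k : ℕ) :
    (Finset.univ.filter fun B : Finset V => B.card ≤ k).card ≤ (Fintype.card V + 1) ^ k := by
  classical
  have h : (Finset.univ.filter fun B : Finset V => B.card ≤ k) ⊆ Finset.univ.image
      fun (g : Fin k → Option V) => Finset.univ.filter fun v => ∃ i, g i = some v := by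
    intro B hB
    have hB := (Finset.mem_filter.1 hB).2
    refine Finset.mem_image.2 ⟨fun i => B.toList[(i : ℕ)]?, Finset.mem_univ _, ?_⟩
    ext v
    simp only [Finset.mem_filter, Finset.mem_univ, true_and]
    rw [← Finset.mem_toList, List.mem_iff_getElem?]
    constructor
    · rintro ⟨i, hi⟩; exact ⟨i, hi⟩
    · rintro ⟨i, hi⟩
      have := (List.getElem?_eq_some_iff.1 hi).1
      exact ⟨⟨i, this.trans_le (by simpa using hB)⟩, hi⟩
  refine (Finset.card_le_card h).trans (Finset.card_image_le.trans ?_)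
  simp

end SmallGenerators

/-! ### Encoding transitive orientations -/

namespace SimpleGraph

/-- `v`, `a` and `b` lie in a common copy of `K_r` in `G`. -/
def CliqueLinked {V : Type*} (G : SimpleGraph V) (r : ℕ) (v a b : V) : Prop :=
  ∃ K : Finset V, G.IsNClique r K ∧ v ∈ K ∧ a ∈ K ∧ b ∈ K

/-- Any `k` neighbours of a vertex include two that lie with it in a common copy of `K_r`. -/
def NeighborsLinked {V : Type*} (G : SimpleGraph V) (r k : ℕ) : Prop :=
  ∀ (v : V) (A : Finset V), A.card = k → (∀ a ∈ A, G.Adj v a) →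
    ∃ a ∈ A, ∃ b ∈ A, a ≠ b ∧ G.CliqueLinked r v a b

end SimpleGraph

section TransitiveOrientations

variable {n r k : ℕ} {G : SimpleGraph (Fin n)} {D D' : Digraph (Fin n)}

lemma Digraph.IsOrientationOf.adj_iff {V : Type*} {D : Digraph V} {G : SimpleGraph V}
    (h : D.IsOrientationOf G) {u v : V} : D.Adj u v ↔ G.Adj u v ∧ ¬ D.Adj v u := by
  refine ⟨fun huv => ⟨h.1 u v huv, ?_⟩, fun huv => ?_⟩
  · rcases h.2 u v (h.1 u v huv) with h | h
    · exact h.2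
    · exact absurd huv h.2
  · rcases h.2 u v huv.1 with h | h
    · exact h.1
    · exact absurd h.1 huv.2

lemma Digraph.ext_of_adj_of_lt {V : Type*} [LinearOrder V] {D D' : Digraph V} {G : SimpleGraph V}
    (h : D.IsOrientationOf G) (h' : D'.IsOrientationOf G)
    (hlt : ∀ u v, u < v → (D.Adj v u ↔ D'.Adj v u)) : D = D' := by
  ext u v
  rcases lt_trichotomy u v with huv | huv | huv
  · rw [h.adj_iff, h'.adj_iff, hlt u v huv]
  · subst huv
    rw [h.adj_iff, h'.adj_iff]; simp
  · exact hlt v u huv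

/-- The arcs `u → w` among the vertices before `v` that lie with `v` in a copy of `K_r`. -/
def Digraph.linkedArc (D : Digraph (Fin n)) (G : SimpleGraph (Fin n)) (r : ℕ) (v u w : Fin n) :
    Prop :=
  u < v ∧ w < v ∧ D.Adj u w ∧ G.CliqueLinked r v u w

/-- Among more than k independent generators two would be linked with v; the edge between them, in
either direction, would be a linked arc. Conversely, transitivity inside a K_r through v propagates
v → u along linked arcs. -/
lemma exists_generators_of_neighborsLinked (hG : G.NeighborsLinked r k)
    (hD : D ∈ G.transitiveOrientations r) (v : Fin n) :
    ∃ B : Finset (Fin n), B.card ≤ k ∧ ∀ u, (u < v ∧ D.Adj v u ↔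
      ∃ b ∈ B, Relation.ReflTransGen (D.linkedArc G r v) b u) := by
  classical
  obtain ⟨B, hBO, hgen, hind⟩ := exists_independent_generators (D.linkedArc G r v)
    (Finset.univ.filter fun u => u < v ∧ D.Adj v u)
  have hB : ∀ b ∈ B, b < v ∧ D.Adj v b := fun b hb => by simpa using hBO hb
  refine ⟨B, ?_, fun u => ⟨fun hu => hgen u (by simpa using hu), ?_⟩⟩
  · by_contra! hk
    obtain ⟨A, hAB, hA⟩ := Finset.exists_subset_card_eq hk.le
    obtain ⟨a, ha, b, hb, hab, K, hK, hvK, haK, hbK⟩ :=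
      hG v A hA fun a ha => hD.1.1 v a (hB a (hAB ha)).2
    rcases hD.1.2 a b (hK.1 haK hbK hab) with h | h
    · exact hind a (hAB ha) b (hAB hb) hab
        ⟨(hB a (hAB ha)).1, (hB b (hAB hb)).1, h.1, K, hK, hvK, haK, hbK⟩
    · exact hind b (hAB hb) a (hAB ha) hab.symm
        ⟨(hB b (hAB hb)).1, (hB a (hAB ha)).1, h.1, K, hK, hvK, hbK, haK⟩
  · rintro ⟨b, hb, hbu⟩
    induction hbu with
    | refl => exact hB b hb
    | tail _ h ih =>
      obtain ⟨_, hw, huw, K, hK, hvK, huK, hwK⟩ := h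
      exact ⟨hw, hD.2 K hK v hvK _ huK _ hwK ih.2 huw⟩

/-- If any `k` neighbours of a vertex include two that lie with it in a common `K_r`, an orientation
in which every `K_r` is transitive is determined by one set of at most `k` vertices per vertex. -/
lemma SimpleGraph.NeighborsLinked.numTransitiveOrientations_le (hG : G.NeighborsLinked r k) :
    G.numTransitiveOrientations r ≤ ((n + 1) ^ k) ^ n := by
  classical
  choose! B hBk hB using fun (D : Digraph (Fin n)) (hD : D ∈ G.transitiveOrientations r) =>
    exists_generators_of_neighborsLinked hG hD
  have h := Set.ncard_le_ncard_of_injOn (s := G.transitiveOrientations r)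
    (t := (Fintype.piFinset fun _ : Fin n =>
      Finset.univ.filter fun B : Finset (Fin n) => B.card ≤ k : Set (Fin n → Finset (Fin n))))
    B (fun D hD => by simpa using hBk D hD) ?_ (Finset.finite_toSet _)
  · rw [Set.ncard_coe_finset, Fintype.card_piFinset_const] at h
    refine h.trans (Nat.pow_le_pow_left ?_ _)
    simpa using card_filter_card_le (V := Fin n) k
  · intro D hD D' hD' hDD'
    refine Digraph.ext_of_adj_of_lt hD.1 hD'.1 fun u v huv => ?_
    -- Linked arcs at v involve only earlier vertices, where the orientations agree by induction.
    -- Equal generators then give equal out-neighbours.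
    induction v using WellFoundedLT.induction generalizing u with
    | _ v ih =>
      have harc : ∀ a w, a < v → w < v → (D.Adj a w ↔ D'.Adj a w) := by
        intro a w ha hw
        rcases lt_trichotomy a w with haw | rfl | haw
        · rw [hD.1.adj_iff, hD'.1.adj_iff, ih w hw a haw]
        · rw [hD.1.adj_iff, hD'.1.adj_iff]; simp
        · exact ih a ha w haw
      have hR : D.linkedArc G r v = D'.linkedArc G r v := by
        funext a w
        simp only [Digraph.linkedArc, eq_iff_iff]
        exact and_congr_right fun ha => and_congr_right fun hw =>
          and_congr_left fun _ => harc a w ha hw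
      have h1 := hB D hD v u
      have h2 := hB D' hD' v u
      rw [hDD', hR, ← h2] at h1
      simpa [huv] using h1

lemma SimpleGraph.numTransitiveOrientations_le_two_pow [Fintype G.edgeSet] :
    G.numTransitiveOrientations r ≤ 2 ^ G.edgeFinset.card := by
  classical
  have h := Set.ncard_le_ncard_of_injOn (s := G.transitiveOrientations r)
    (t := (G.edgeFinset.powerset : Set (Finset (Sym2 (Fin n)))))
    (fun D => G.edgeFinset.filter fun e => ∃ u v, u < v ∧ e = s(v, u) ∧ D.Adj v u)
    (fun D _ => by simp) ?_ (Finset.finite_toSet _)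
  · rwa [Set.ncard_coe_finset, Finset.card_powerset] at h
  · have key : ∀ D ∈ G.transitiveOrientations r, ∀ u v : Fin n, u < v → (D.Adj v u ↔
        s(v, u) ∈ G.edgeFinset.filter fun e => ∃ u v, u < v ∧ e = s(v, u) ∧ D.Adj v u) := by
      intro D hD u v huv
      rw [Finset.mem_filter, SimpleGraph.mem_edgeFinset, SimpleGraph.mem_edgeSet]
      refine ⟨fun h => ⟨hD.1.1 v u h, u, v, huv, rfl, h⟩, ?_⟩
      rintro ⟨-, u', v', huv', he, h⟩
      rcases Sym2.eq_iff.1 he with ⟨rfl, rfl⟩ | ⟨rfl, rfl⟩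
      · exact h
      · exact absurd huv huv'.asymm
    intro D hD D' hD' hDD'
    refine Digraph.ext_of_adj_of_lt hD.1 hD'.1 fun u v huv => ?_
    rw [key D hD u v huv, key D' hD' u v huv]
    simp only at hDD'
    rw [hDD']

end TransitiveOrientations

/-! ### Janson's inequality for partite copies of a pattern -/

section PartiteCopies

variable {ι V : Type*} [Fintype ι] [DecidableEq ι] [DecidableEq V]

lemma card_piFinset_agree_mul (W : ι → Finset V) {f : ι → V} (hf : f ∈ Fintype.piFinset W)
    (J : Finset ι) :
    ((Fintype.piFinset W).filter fun g => ∀ i ∈ J, f i = g i).card * ∏ i ∈ J, (W i).card =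
      ∏ i, (W i).card := by
  have h : ((Fintype.piFinset W).filter fun g => ∀ i ∈ J, f i = g i) =
      Fintype.piFinset fun i => if i ∈ J then {f i} else W i := by
    ext g
    simp only [Finset.mem_filter, Fintype.mem_piFinset] at hf ⊢
    constructor
    · intro h i
      by_cases hi : i ∈ J
      · simp [hi, h.2 i hi]
      · simpa [hi] using h.1 i
    · intro h
      refine ⟨fun i => ?_, fun i hi => ?_⟩
      · have := h i
        by_cases hi : i ∈ J
        · simp only [hi, if_true, Finset.mem_singleton] at this
          rw [this]; exact hf i
        · simpa [hi] using this
      · have := h i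
        simp only [hi, if_true, Finset.mem_singleton] at this
        exact this.symm
  rw [h, Fintype.card_piFinset, ← Finset.prod_compl_mul_prod J (fun i => (W i).card),
    ← Finset.prod_compl_mul_prod J]
  congr 1
  rw [Finset.prod_eq_one (s := J), mul_one]
  · exact Finset.prod_congr rfl fun i hi => by simp [Finset.mem_compl.1 hi]
  · intro i hi; simp [hi]

/-- The edges of the pattern `P` that lie inside `J`. -/
def edgesWithin (P : Finset (Sym2 ι)) (J : Finset ι) : Finset (Sym2 ι) :=
  P.filter fun e => ∀ i ∈ e, i ∈ J

/-- The colouring c recovers i from f i, so two partite copies can share an edge only by placing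
both its ends identically. -/
lemma image_inter_image_of_partite {W : ι → Finset V} {c : V → ι}
    (hc : ∀ i, ∀ x ∈ W i, c x = i) (P : Finset (Sym2 ι)) {f g : ι → V}
    (hf : f ∈ Fintype.piFinset W) (hg : g ∈ Fintype.piFinset W) :
    P.image (Sym2.map f) ∩ P.image (Sym2.map g) =
      (edgesWithin P (Finset.univ.filter fun i => f i = g i)).image (Sym2.map f) := by
  rw [Fintype.mem_piFinset] at hf hg
  have hcf : ∀ i, c (f i) = i := fun i => hc i _ (hf i)
  have hcg : ∀ i, c (g i) = i := fun i => hc i _ (hg i)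
  ext e
  simp only [edgesWithin, Finset.mem_inter, Finset.mem_image, Finset.mem_filter, Finset.mem_univ,
    true_and]
  constructor
  · rintro ⟨⟨a, ha, rfl⟩, b, hb, hab⟩
    refine ⟨a, ⟨ha, ?_⟩, rfl⟩
    induction a using Sym2.ind with
    | _ x y =>
      induction b using Sym2.ind with
      | _ z w =>
        simp only [Sym2.map_mk, Sym2.mem_iff] at hab ⊢
        rcases Sym2.eq_iff.1 hab with ⟨h1, h2⟩ | ⟨h1, h2⟩
        · have e1 : z = x := by rw [← hcg z, h1, hcf]
          have e2 : w = y := by rw [← hcg w, h2, hcf]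
          subst e1 e2
          rintro i (rfl | rfl)
          exacts [h1.symm, h2.symm]
        · have e1 : z = y := by rw [← hcg z, h1, hcf]
          have e2 : w = x := by rw [← hcg w, h2, hcf]
          subst e1 e2
          rintro i (rfl | rfl)
          exacts [h2.symm, h1.symm]
  · rintro ⟨a, ⟨ha, hJ⟩, rfl⟩
    exact ⟨⟨a, ha, rfl⟩, a, ha, Sym2.map_congr fun i hi => (hJ i hi).symm⟩

/-- **Janson's inequality** for the copies of a pattern `P` with one vertex in each of the disjoint
sets `W i`: none of them is present with probability exponentially small in the least expected
number of copies of a sub-pattern with an edge. -/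
theorem bernExp_no_partite_copy_le [Fintype V] {p : ℝ} (hp0 : 0 < p) {w : Sym2 V → ℝ}
    (hw0 : ∀ e, 0 ≤ w e) (hw1 : ∀ e, w e ≤ 1) (hw : ∀ e, ¬ e.IsDiag → w e = p)
    {W : ι → Finset V} {c : V → ι} (hc : ∀ i, ∀ x ∈ W i, c x = i) {P : Finset (Sym2 ι)}
    (hP : ∀ e ∈ P, ¬ e.IsDiag) (hne : P.Nonempty) {lam : ℝ} (hlam : 0 < lam)
    (h : ∀ J, (edgesWithin P J).Nonempty →
      lam ≤ (∏ i ∈ J, ((W i).card : ℝ)) * p ^ (edgesWithin P J).card) :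
    bernExp w (fun S => if ∀ f ∈ Fintype.piFinset W, ¬ P.image (Sym2.map f) ⊆ S then 1 else 0) ≤
      Real.exp (-(lam / 2 ^ (Fintype.card ι + 2))) := by
  classical
  set F := Fintype.piFinset W with hF
  set Q : (ι → V) → Finset (Sym2 V) := fun f => P.image (Sym2.map f) with hQ
  obtain ⟨N, hN⟩ : ∃ N : ℝ, N = ∏ i, ((W i).card : ℝ) := ⟨_, rfl⟩
  obtain ⟨μ, hμ⟩ : ∃ μ : ℝ, μ = N * p ^ P.card := ⟨_, rfl⟩
  have hcol : ∀ f ∈ F, ∀ i, c (f i) = i := fun f hf i => hc i _ (Fintype.mem_piFinset.1 hf i)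
  have hinj : ∀ f ∈ F, Function.Injective f := fun f hf i j hij => by
    rw [← hcol f hf i, hij, hcol f hf]
  have hcard : ∀ f ∈ F, ∀ R : Finset (Sym2 ι), (R.image (Sym2.map f)).card = R.card :=
    fun f hf R => Finset.card_image_of_injective _ (Sym2.map.injective (hinj f hf))
  have hdiag : ∀ f ∈ F, ∀ e ∈ Q f, w e = p := by
    intro f hf e he
    obtain ⟨a, ha, rfl⟩ := Finset.mem_image.1 he
    exact hw _ (by rw [Sym2.isDiag_map (hinj f hf)]; exact hP a ha)
  have hprod : ∀ f ∈ F, ∏ e ∈ Q f, w e = p ^ P.card := fun f hf => by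
    rw [Finset.prod_congr rfl (hdiag f hf), Finset.prod_const, hcard f hf]
  have hprod2 : ∀ f ∈ F, ∀ g ∈ F, (∏ e ∈ Q f ∪ Q g, w e) *
      p ^ (edgesWithin P (Finset.univ.filter fun i => f i = g i)).card = (p ^ P.card) ^ 2 := by
    intro f hf g hg
    rw [Finset.prod_congr rfl (fun e he => (Finset.mem_union.1 he).elim (hdiag f hf e)
      (hdiag g hg e)), Finset.prod_const, ← pow_add, ← pow_mul,
      ← hcard f hf, ← image_inter_image_of_partite hc P hf hg,
      Finset.card_union_add_card_inter, hcard f hf, hcard g hg, mul_two]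
  have hF_card : (F.card : ℝ) = N := by rw [hF, Fintype.card_piFinset, hN]; push_cast; rfl
  have hμsum : ∑ f ∈ F, ∏ e ∈ Q f, w e = μ := by
    rw [Finset.sum_congr rfl hprod, Finset.sum_const, nsmul_eq_mul, hF_card, hμ]
  have hlamμ : lam ≤ μ := by
    have e : edgesWithin P Finset.univ = P := by simp [edgesWithin]
    have := h Finset.univ (by rwa [e])
    rwa [e, ← hN, ← hμ] at this
  have hμ0 : 0 < μ := hlam.trans_le hlamμ
  have hpat : ∀ X : ℝ, 0 ≤ X →
      ∑ J with (edgesWithin P J).Nonempty, X ≤ 2 ^ Fintype.card ι * X := fun X hX => by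
    refine (Finset.sum_le_sum_of_subset_of_nonneg (Finset.filter_subset _ _)
      fun _ _ _ => hX).trans (le_of_eq ?_)
    simp
  -- The maps agreeing with f on J number N / ∏ |W i| over i in J, and the hypothesis for J bounds
  -- that product times p^e(J) below by `lam`.
  have hagree : ∀ f ∈ F, ∀ J, (edgesWithin P J).Nonempty →
      ∑ g ∈ F with ∀ i ∈ J, f i = g i, (p ^ P.card) ^ 2 / p ^ (edgesWithin P J).card ≤
        μ * p ^ P.card / lam := by
    intro f hf J hJ
    have hΦ := h J hJ
    have hcnt : (((F.filter fun g => ∀ i ∈ J, f i = g i).card : ℕ) : ℝ) *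
        ∏ i ∈ J, ((W i).card : ℝ) = N := by
      have := card_piFinset_agree_mul W hf J
      rw [hN]; exact_mod_cast this
    rw [Finset.sum_const, nsmul_eq_mul, le_div_iff₀ hlam, mul_div_assoc', div_mul_eq_mul_div,
      div_le_iff₀ (by positivity)]
    calc _ ≤ (((F.filter fun g => ∀ i ∈ J, f i = g i).card : ℕ) : ℝ) * (p ^ P.card) ^ 2 *
        ((∏ i ∈ J, ((W i).card : ℝ)) * p ^ (edgesWithin P J).card) :=
          mul_le_mul_of_nonneg_left hΦ (by positivity)
      _ = _ := by rw [hμ, ← hcnt]; ring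
  have hinner : ∀ f ∈ F, ∑ g ∈ F with ¬ Disjoint (Q f) (Q g), ∏ e ∈ Q f ∪ Q g, w e ≤
      2 ^ Fintype.card ι * (μ * p ^ P.card / lam) := by
    intro f hf
    -- Each intersecting pair is charged to its exact agreement set, one nonnegative term of the sum
    -- over J.
    calc ∑ g ∈ F with ¬ Disjoint (Q f) (Q g), ∏ e ∈ Q f ∪ Q g, w e
        ≤ ∑ g ∈ F, ∑ J with (edgesWithin P J).Nonempty, if ∀ i ∈ J, f i = g i then
            (p ^ P.card) ^ 2 / p ^ (edgesWithin P J).card else 0 := by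
          rw [Finset.sum_filter]
          refine Finset.sum_le_sum fun g hg => ?_
          by_cases hd : Disjoint (Q f) (Q g)
          swap
          · rw [if_pos hd]
            refine le_trans ?_ (Finset.single_le_sum (fun J _ => ?_) (Finset.mem_filter.2
              ⟨Finset.mem_univ (Finset.univ.filter fun i => f i = g i), ?_⟩))
            · rw [if_pos (by simp), le_div_iff₀ (by positivity), hprod2 f hf g hg]
            · split_ifs <;> positivity
            · rw [Finset.not_disjoint_iff_nonempty_inter,
                image_inter_image_of_partite hc P hf hg] at hd
              exact Finset.image_nonempty.1 hd
          · rw [if_neg (not_not.2 hd)]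
            exact Finset.sum_nonneg fun J _ => by split_ifs <;> positivity
      _ = ∑ J with (edgesWithin P J).Nonempty, ∑ g ∈ F with ∀ i ∈ J, f i = g i,
            (p ^ P.card) ^ 2 / p ^ (edgesWithin P J).card := by
          rw [Finset.sum_comm]
          exact Finset.sum_congr rfl fun J _ => (Finset.sum_filter _ _).symm
      _ ≤ ∑ J with (edgesWithin P J).Nonempty, μ * p ^ P.card / lam :=
          Finset.sum_le_sum fun J hJ => hagree f hf J (Finset.mem_filter.1 hJ).2
      _ ≤ 2 ^ Fintype.card ι * (μ * p ^ P.card / lam) :=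
          hpat _ (div_nonneg (mul_nonneg hμ0.le (pow_nonneg hp0.le _)) hlam.le)
  have hΔ : ∑ f ∈ F, ∑ g ∈ F with ¬ Disjoint (Q f) (Q g), ∏ e ∈ Q f ∪ Q g, w e ≤
      2 ^ Fintype.card ι * μ ^ 2 / lam := by
    refine (Finset.sum_le_sum hinner).trans (le_of_eq ?_)
    rw [Finset.sum_const, nsmul_eq_mul, hF_card, hμ]; ring
  have h2 : (0 : ℝ) < 2 ^ (Fintype.card ι + 1) := pow_pos two_pos _
  -- This choice makes the bound on the quadratic term equal to half of θμ; θ ≤ 1 follows from lam ≤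
  -- μ.
  obtain ⟨θ, hθ⟩ : ∃ θ : ℝ, θ = lam / (2 ^ (Fintype.card ι + 1) * μ) := ⟨_, rfl⟩
  have hθ0 : 0 ≤ θ := hθ ▸ (div_pos hlam (mul_pos h2 hμ0)).le
  have hθ1 : θ ≤ 1 := by
    rw [hθ, div_le_one (mul_pos h2 hμ0)]
    have : (1 : ℝ) ≤ 2 ^ (Fintype.card ι + 1) := one_le_pow₀ (by norm_num)
    nlinarith
  refine (bernExp_mono hw0 hw1 fun S => ?_).trans
    ((bernExp_jansonProd_le hw0 hw1 F Q hθ0 hθ1).trans (Real.exp_le_exp.2 ?_))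
  · split_ifs with hS
    · refine le_of_eq (Finset.prod_eq_one fun f hf => ?_).symm
      simp [hQ, hS f hf]
    · exact jansonProd_nonneg hθ0 hθ1 S
  · rw [hμsum]
    have h1 := mul_le_mul_of_nonneg_left hΔ (sq_nonneg θ)
    have e1 : θ * μ = lam / 2 ^ (Fintype.card ι + 1) := by rw [hθ]; field_simp
    have e2 : θ ^ 2 * (2 ^ Fintype.card ι * μ ^ 2 / lam) = lam / 2 ^ (Fintype.card ι + 2) := by
      rw [hθ]; field_simp; ring
    have e3 : lam / 2 ^ (Fintype.card ι + 1) = 2 * (lam / 2 ^ (Fintype.card ι + 2)) := by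
      field_simp; ring
    rw [e2] at h1
    linarith

end PartiteCopies

/-! ### The binomial random graph as a random subset of pairs -/

section RandomGraph

/-- The probability that a pair is an edge of the binomial random graph. -/
noncomputable def edgeProb (V : Type*) [DecidableEq V] (p : ℝ) (e : Sym2 V) : ℝ :=
  if e.IsDiag then 0 else p

lemma edgeProb_nonneg {V : Type*} [DecidableEq V] {p : ℝ} (hp : 0 ≤ p) (e : Sym2 V) : 0 ≤ edgeProb V p e := by
  unfold edgeProb; split_ifs <;> [rfl; exact hp]

lemma edgeProb_le_one {V : Type*} [DecidableEq V] {p : ℝ} (hp : p ≤ 1) (e : Sym2 V) : edgeProb V p e ≤ 1 := by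
  unfold edgeProb; split_ifs <;> [norm_num; exact hp]

variable {V : Type*} [Fintype V] [DecidableEq V]

lemma bernWeight_edgeFinset (p : ℝ) (G : SimpleGraph V) [DecidableRel G.Adj] :
    bernWeight (edgeProb V p) G.edgeFinset =
      p ^ G.edgeFinset.card * (1 - p) ^ ((Fintype.card V).choose 2 - G.edgeFinset.card) := by
  have h1 : ∏ e ∈ G.edgeFinset, edgeProb V p e = p ^ G.edgeFinset.card := by
    rw [Finset.prod_congr rfl (g := fun _ => p), Finset.prod_const]
    intro e he
    rw [edgeProb, if_neg (G.not_isDiag_of_mem_edgeFinset he)]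
  have h2 : ∏ e ∈ G.edgeFinsetᶜ, (1 - edgeProb V p e) =
      (1 - p) ^ ((Fintype.card V).choose 2 - G.edgeFinset.card) := by
    have hsub : (Finset.univ.filter fun e : Sym2 V => ¬ e.IsDiag) \ G.edgeFinset ⊆
        G.edgeFinsetᶜ := fun e he => by
      rw [Finset.mem_compl]; exact (Finset.mem_sdiff.1 he).2
    rw [← Finset.prod_subset hsub, Finset.prod_congr rfl (g := fun _ => 1 - p),
      Finset.prod_const, Finset.card_sdiff_of_subset]
    · congr 2
      rw [← Sym2.card_subtype_not_diag, Fintype.card_subtype]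
    · intro e he
      exact Finset.mem_filter.2 ⟨Finset.mem_univ _, G.not_isDiag_of_mem_edgeFinset he⟩
    · intro e he
      rw [edgeProb, if_neg (Finset.mem_filter.1 (Finset.mem_sdiff.1 he).1).2]
    · intro e he he'
      have : e.IsDiag := by
        by_contra hd
        exact he' (Finset.mem_sdiff.2 ⟨Finset.mem_filter.2 ⟨Finset.mem_univ _, hd⟩,
          Finset.mem_compl.1 he⟩)
      rw [edgeProb, if_pos this, sub_zero]
  rw [bernWeight, h1, h2]

open Classical in
-- Diagonal pairs have probability 0, so sets containing one have weight 0, and the remaining sets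
-- are exactly the edge sets of graphs.
lemma binomialRandom_real_eq_bernExp (p : unitInterval) (B : Set (SimpleGraph V)) :
    (SimpleGraph.binomialRandom V p).real B = bernExp (edgeProb V p) (fun S =>
      if SimpleGraph.fromEdgeSet (S : Set (Sym2 V)) ∈ B then 1 else 0) := by
  have hB : B = ((Finset.univ.filter (· ∈ B) : Finset (SimpleGraph V)) : Set (SimpleGraph V)) := by
    simp
  have hs : ∀ G : SimpleGraph V, (SimpleGraph.binomialRandom V p).real {G} =
      bernWeight (edgeProb V p) G.edgeFinset := fun G => by
    rw [bernWeight_edgeFinset, MeasureTheory.measureReal_def, SimpleGraph.binomialRandom_singleton]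
    simp [← SimpleGraph.coe_edgeFinset, Set.ncard_coe_finset]
  have : MeasurableSingletonClass (SimpleGraph V) := ⟨fun G => by
    rw [← SimpleGraph.measurableEmbedding_edgeSet.measurableSet_image, Set.image_singleton]
    exact measurableSet_singleton _⟩
  conv_lhs => rw [hB]
  rw [← MeasureTheory.sum_measureReal_singleton, Finset.sum_filter, bernExp]
  refine Finset.sum_of_injOn (fun G => G.edgeFinset) (fun G _ G' _ h => ?_) (fun _ _ => by simp)
    ?_ ?_
  · exact SimpleGraph.edgeFinset_inj.1 h
  · intro S _ hS
    obtain ⟨e, he, hd⟩ : ∃ e ∈ S, e.IsDiag := by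
      by_contra! h
      refine hS ⟨SimpleGraph.fromEdgeSet (S : Set (Sym2 V)), by simp, ?_⟩
      ext e
      simp only [SimpleGraph.mem_edgeFinset, SimpleGraph.edgeSet_fromEdgeSet, Set.mem_sdiff,
        Finset.mem_coe]
      exact ⟨fun h => h.1, fun he => ⟨he, h e he⟩⟩
    rw [bernWeight, Finset.prod_eq_zero he (by rw [edgeProb, if_pos hd])]
    simp
  · intro G _
    rw [hs]
    simp

end RandomGraph

/-! ### The rooted clique pattern -/

section RootedCliques

variable {t : ℕ}

/-- The vertices of the rooted clique pattern: a root, two marked neighbours of the root, and `t`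
further vertices. -/
abbrev RootedVertex (t : ℕ) : Type := Option (Fin 2 ⊕ Fin t)

/-- The edges of a clique on the rooted vertices, except for those between the root and the two
marked vertices. -/
def rootedPattern (t : ℕ) : Finset (Sym2 (RootedVertex t)) :=
  Finset.univ.filter fun e => ¬ e.IsDiag ∧ ∀ a : Fin 2, e ≠ s(none, some (Sum.inl a))

/-- The marked vertices in `J`. -/
def markedPart (J : Finset (RootedVertex t)) : Finset (RootedVertex t) :=
  J.filter fun x => ∃ a : Fin 2, x = some (Sum.inl a)

/-- The vertices in `J` that are neither the root nor marked. -/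
def freePart (J : Finset (RootedVertex t)) : Finset (RootedVertex t) :=
  J.filter fun x => ∃ i : Fin t, x = some (Sum.inr i)

lemma card_markedPart_le (J : Finset (RootedVertex t)) : (markedPart J).card ≤ 2 := by
  have h : markedPart J ⊆ Finset.univ.image fun a : Fin 2 => some (Sum.inl a) := fun x hx => by
    obtain ⟨a, rfl⟩ := (Finset.mem_filter.1 hx).2
    exact Finset.mem_image_of_mem _ (Finset.mem_univ a)
  exact (Finset.card_le_card h).trans (Finset.card_image_le.trans (by simp))

lemma card_freePart_le (J : Finset (RootedVertex t)) : (freePart J).card ≤ t := by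
  have h : freePart J ⊆ Finset.univ.image fun a : Fin t => some (Sum.inr a) := fun x hx => by
    obtain ⟨a, rfl⟩ := (Finset.mem_filter.1 hx).2
    exact Finset.mem_image_of_mem _ (Finset.mem_univ a)
  exact (Finset.card_le_card h).trans (Finset.card_image_le.trans (by simp))

lemma mem_markedPart_union_freePart {J : Finset (RootedVertex t)} {x : RootedVertex t}
    (hx : x ∈ J) (h : x ≠ none) : x ∈ markedPart J ∪ freePart J := by
  rcases x with _ | a | i
  · exact absurd rfl h
  · exact Finset.mem_union_left _ (Finset.mem_filter.2 ⟨hx, a, rfl⟩)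
  · exact Finset.mem_union_right _ (Finset.mem_filter.2 ⟨hx, i, rfl⟩)

lemma eq_or_offDiag_of_mem_edgesWithin {J : Finset (RootedVertex t)}
    {e : Sym2 (RootedVertex t)} (he : e ∈ edgesWithin (rootedPattern t) J) :
    e ∈ (markedPart J ∪ freePart J).offDiag.image Sym2.mk.uncurry ∨
      e ∈ (freePart J).image fun x => s(none, x) := by
  obtain ⟨heP, heJ⟩ := Finset.mem_filter.1 he
  obtain ⟨-, hd, hm⟩ := Finset.mem_filter.1 heP
  have root : ∀ x, x ∈ J → x ≠ none → (∀ a : Fin 2, s(none, x) ≠ s(none, some (Sum.inl a))) →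
      x ∈ freePart J := by
    intro x hx hne hxm
    rcases Finset.mem_union.1 (mem_markedPart_union_freePart hx hne) with h | h
    · obtain ⟨a, rfl⟩ := (Finset.mem_filter.1 h).2
      exact absurd rfl (hxm a)
    · exact h
  induction e using Sym2.ind with
  | _ x y =>
    have hxy : x ≠ y := fun h => hd (by simpa using h)
    have hx := heJ x (Sym2.mem_mk_left x y)
    have hy := heJ y (Sym2.mem_mk_right x y)
    by_cases h1 : x = none
    · subst h1
      exact Or.inr (Finset.mem_image.2 ⟨y, root y hy hxy.symm hm, rfl⟩)
    · by_cases h2 : y = none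
      · subst h2
        refine Or.inr (Finset.mem_image.2 ⟨x, root x hx h1 ?_, Sym2.eq_swap⟩)
        rwa [Sym2.eq_swap]
      · exact Or.inl (Finset.mem_image.2 ⟨(x, y), Finset.mem_offDiag.2
          ⟨mem_markedPart_union_freePart hx h1, mem_markedPart_union_freePart hy h2, hxy⟩, rfl⟩)

/-- The root is counted as if it were in J. Overcounting edges only lowers the expectation, as p ≤
1. -/
lemma card_edgesWithin_rootedPattern_le (J : Finset (RootedVertex t)) :
    (edgesWithin (rootedPattern t) J).card ≤
      ((markedPart J).card + (freePart J).card).choose 2 + (freePart J).card := by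
  have h : edgesWithin (rootedPattern t) J ⊆
      (markedPart J ∪ freePart J).offDiag.image Sym2.mk.uncurry ∪
        (freePart J).image fun x => s(none, x) := fun e he =>
    Finset.mem_union.2 (eq_or_offDiag_of_mem_edgesWithin he)
  refine (Finset.card_le_card h).trans ((Finset.card_union_le _ _).trans ?_)
  refine add_le_add ?_ Finset.card_image_le
  rw [Sym2.card_image_offDiag]
  exact Nat.choose_le_choose 2 (Finset.card_union_le _ _)

/-- With no free vertex and at most one marked vertex, the only possible pair joins the root to a
marked vertex, and the pattern omits it. -/
lemma two_le_or_one_le_of_edgesWithin_nonempty {J : Finset (RootedVertex t)}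
    (h : (edgesWithin (rootedPattern t) J).Nonempty) :
    2 ≤ (markedPart J).card ∨ 1 ≤ (freePart J).card := by
  by_contra! hlt
  have h0 : (freePart J).card = 0 := by omega
  have h1 := card_edgesWithin_rootedPattern_le J
  rw [h0, Nat.choose_eq_zero_of_lt (by omega)] at h1
  exact absurd (Finset.card_pos.2 h) (by omega)

lemma prod_card_rootedVertex {s m : ℕ} {size : RootedVertex t → ℕ} (h0 : size none = 1)
    (h1 : ∀ a, size (some (Sum.inl a)) = s) (h2 : ∀ i, size (some (Sum.inr i)) = m)
    (J : Finset (RootedVertex t)) :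
    ∏ x ∈ J, (size x : ℝ) = (s : ℝ) ^ (markedPart J).card * (m : ℝ) ^ (freePart J).card := by
  classical
  have h : ∀ x ∈ J, (size x : ℝ) = (if ∃ a : Fin 2, x = some (Sum.inl a) then (s : ℝ) else 1) *
      (if ∃ i : Fin t, x = some (Sum.inr i) then (m : ℝ) else 1) := by
    rintro (_ | a | i) _ <;> simp [h0, h1, h2]
  rw [Finset.prod_congr rfl h, Finset.prod_mul_distrib, Finset.prod_ite, Finset.prod_ite]
  simp only [Finset.prod_const, one_pow, mul_one]
  congr!

lemma card_rootedVertex (t : ℕ) : Fintype.card (RootedVertex t) = t + 3 := by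
  simp; ring

lemma exists_disjoint_parts {V : Type*} [DecidableEq V] {R : Finset V} {k m : ℕ}
    (h : k * m ≤ R.card) : ∃ U : Fin k → Finset V, (∀ i, U i ⊆ R) ∧ (∀ i, (U i).card = m) ∧
      ∀ i j x, x ∈ U i → x ∈ U j → i = j := by
  obtain ⟨e⟩ : Nonempty (Fin k × Fin m ↪ R) :=
    Function.Embedding.nonempty_of_card_le (by simpa using h)
  refine ⟨fun i => Finset.univ.image fun j => (e (i, j) : V), fun i x hx => ?_, fun i => ?_,
    fun i j x hi hj => ?_⟩
  · obtain ⟨j, -, rfl⟩ := Finset.mem_image.1 hx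
    exact (e (i, j)).2
  · rw [Finset.card_image_of_injective, Finset.card_univ, Fintype.card_fin]
    intro j j' hjj
    simpa using e.injective (Subtype.ext hjj)
  · obtain ⟨a, -, rfl⟩ := Finset.mem_image.1 hi
    obtain ⟨b, -, hb⟩ := Finset.mem_image.1 hj
    have := e.injective (Subtype.ext hb)
    simp only [Prod.mk.injEq] at this
    exact this.1.symm

lemma exists_color {ι V : Type*} [Nonempty ι] {W : ι → Finset V}
    (h : ∀ i j x, x ∈ W i → x ∈ W j → i = j) : ∃ c : V → ι, ∀ i, ∀ x ∈ W i, c x = i := by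
  classical
  refine ⟨fun x => if hx : ∃ i, x ∈ W i then hx.choose else Classical.arbitrary ι,
    fun i x hx => ?_⟩
  have hex : ∃ i, x ∈ W i := ⟨i, hx⟩
  simp only [hex, dif_pos]
  exact h _ _ _ hex.choose_spec hx

/-- If every pair of the rooted pattern that is placed by `f` is an edge of `G`, and `f` sends the
marked vertices to neighbours of `f none`, then the image of `f` is a clique. -/
lemma cliqueLinked_of_rootedPattern {V : Type*} [DecidableEq V] {G : SimpleGraph V}
    {f : RootedVertex t → V} (hf : Function.Injective f)
    (hmark : ∀ a, G.Adj (f none) (f (some (Sum.inl a))))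
    (hP : ∀ e ∈ rootedPattern t, Sym2.map f e ∈ G.edgeSet) :
    G.CliqueLinked (t + 3) (f none) (f (some (Sum.inl 0))) (f (some (Sum.inl 1))) := by
  refine ⟨Finset.univ.image f, ⟨?_, ?_⟩, by simp, by simp, by simp⟩
  · intro u hu v hv huv
    simp only [Finset.coe_image, Finset.coe_univ, Set.image_univ, Set.mem_range] at hu hv
    obtain ⟨i, rfl⟩ := hu
    obtain ⟨j, rfl⟩ := hv
    have hij : i ≠ j := fun h => huv (h ▸ rfl)
    by_cases h : ∀ a : Fin 2, s(i, j) ≠ s(none, some (Sum.inl a))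
    · exact hP s(i, j) (Finset.mem_filter.2 ⟨Finset.mem_univ _, by simpa using hij, h⟩)
    · push Not at h
      obtain ⟨a, ha⟩ := h
      rcases Sym2.eq_iff.1 ha with ⟨rfl, rfl⟩ | ⟨rfl, rfl⟩
      · exact hmark a
      · exact (hmark a).symm
  · rw [Finset.card_image_of_injective _ hf, Finset.card_univ, card_rootedVertex]

end RootedCliques

/-! ### Probability that neighbours fail to be linked -/

section NeighborsLinked

variable {t n s m : ℕ} {p : unitInterval} {lam : ℝ}

open Classical in
-- The pattern omits the edges from the root to the marked vertices because the event itself makes A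
-- adjacent to v. The event thus lies inside the absence of a partite copy, and no conditioning is
-- needed.
lemma binomialRandom_not_linked_le (hp : 0 < (p : ℝ)) (hlam : 0 < lam) (hm : t * m + 2 * s + 1 ≤ n)
    (h : ∀ i j : ℕ, i ≤ 2 → j ≤ t → (2 ≤ i ∨ 1 ≤ j) →
      lam ≤ (s : ℝ) ^ i * (m : ℝ) ^ j * (p : ℝ) ^ ((i + j).choose 2 + j))
    (v : Fin n) (A : Finset (Fin n)) (hA : A.card = 2 * s) :
    (SimpleGraph.binomialRandom (Fin n) p).real {G | (∀ a ∈ A, G.Adj v a) ∧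
      ¬ ∃ a ∈ A, ∃ b ∈ A, a ≠ b ∧ G.CliqueLinked (t + 3) v a b} ≤
      Real.exp (-(lam / 2 ^ (t + 5))) := by
  by_cases hvA : v ∈ A
  · have : {G : SimpleGraph (Fin n) | (∀ a ∈ A, G.Adj v a) ∧
        ¬ ∃ a ∈ A, ∃ b ∈ A, a ≠ b ∧ G.CliqueLinked (t + 3) v a b} = ∅ := by
      ext G
      simp only [Set.mem_ofPred_eq, Set.mem_empty_iff_false, iff_false, not_and]
      exact fun hG => absurd (hG v hvA) (G.loopless.irrefl v)
    rw [this, MeasureTheory.measureReal_empty]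
    exact Real.exp_nonneg _
  -- The halves of A host the two marked vertices; t disjoint blocks away from A and v host the free
  -- ones.
  obtain ⟨X, hXA, hXc, hXd⟩ := exists_disjoint_parts (R := A) (k := 2) (m := s) hA.ge
  obtain ⟨Y, hYA, hYc, hYd⟩ := exists_disjoint_parts (R := (insert v A)ᶜ) (k := t) (m := m) (by
    rw [Finset.card_compl, Finset.card_insert_of_notMem hvA, hA, Fintype.card_fin]; omega)
  set W : RootedVertex t → Finset (Fin n) := fun x => match x with
    | none => {v}
    | some (Sum.inl a) => X a
    | some (Sum.inr i) => Y i with hW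
  have hYn : ∀ i x, x ∈ Y i → x ≠ v ∧ x ∉ A := fun i x hx => by
    simpa using hYA i hx
  have hdisj : ∀ i j x, x ∈ W i → x ∈ W j → i = j := by
    rintro (_ | a | i) (_ | b | j) x hi hj <;> simp only [hW, Finset.mem_singleton] at hi hj
    · rfl
    · exact absurd (hXA b hj) (hi ▸ hvA)
    · exact absurd hi (hYn j x hj).1
    · exact absurd (hXA a hi) (hj ▸ hvA)
    · rw [hXd a b x hi hj]
    · exact absurd (hXA a hi) (hYn j x hj).2
    · exact absurd hj (hYn i x hi).1
    · exact absurd (hXA b hj) (hYn i x hi).2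
    · rw [hYd i j x hi hj]
  obtain ⟨c, hc⟩ := exists_color hdisj
  have hp0 : (0 : ℝ) ≤ p := p.2.1
  have hp1 : (p : ℝ) ≤ 1 := p.2.2
  rw [binomialRandom_real_eq_bernExp]
  have key := bernExp_no_partite_copy_le (V := Fin n) hp (w := edgeProb (Fin n) p)
    (edgeProb_nonneg hp0) (edgeProb_le_one hp1) (fun e he => by rw [edgeProb, if_neg he]) hc
    (P := rootedPattern t) (fun e he => (Finset.mem_filter.1 he).2.1)
    ⟨s(some (Sum.inl 0), some (Sum.inl 1)), by simp [rootedPattern]⟩ hlam ?_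
  · rw [card_rootedVertex] at key
    refine (bernExp_mono (edgeProb_nonneg hp0) (edgeProb_le_one hp1) fun S => ?_).trans key
    by_cases hS : ∀ f ∈ Fintype.piFinset W, ¬ (rootedPattern t).image (Sym2.map f) ⊆ S
    · rw [if_pos hS]; split_ifs <;> norm_num
    rw [if_neg hS, if_neg]
    push Not at hS
    obtain ⟨f, hf, hfS⟩ := hS
    rw [Fintype.mem_piFinset] at hf
    have hinj : Function.Injective f := fun i j hij =>
      hdisj i j (f i) (hf i) (hij ▸ hf j)
    have hv : f none = v := by simpa [hW] using hf none
    have hX : ∀ a, f (some (Sum.inl a)) ∈ A := fun a => hXA a (hf (some (Sum.inl a)))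
    rintro ⟨hadj, hno⟩
    refine hno ⟨_, hX 0, _, hX 1, fun h => ?_, ?_⟩
    · simpa using hinj h
    · rw [← hv]
      refine cliqueLinked_of_rootedPattern hinj (fun a => hv ▸ hadj _ (hX a)) fun e he => ?_
      rw [SimpleGraph.edgeSet_fromEdgeSet]
      refine ⟨hfS (Finset.mem_image_of_mem _ he), ?_⟩
      have : ¬ (Sym2.map f e).IsDiag := by
        rw [Sym2.isDiag_map hinj]; exact (Finset.mem_filter.1 he).2.1
      simpa using this
  · intro J hJ
    refine (h _ _ (card_markedPart_le J) (card_freePart_le J)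
      (two_le_or_one_le_of_edgesWithin_nonempty hJ)).trans ?_
    rw [prod_card_rootedVertex (size := fun x => (W x).card) (by simp [hW]) hXc hYc J]
    exact mul_le_mul_of_nonneg_left (pow_le_pow_of_le_one hp0 hp1
      (card_edgesWithin_rootedPattern_le J)) (by positivity)

lemma binomialRandom_not_neighborsLinked_le (hp : 0 < (p : ℝ)) (hlam : 0 < lam)
    (hm : t * m + 2 * s + 1 ≤ n)
    (h : ∀ i j : ℕ, i ≤ 2 → j ≤ t → (2 ≤ i ∨ 1 ≤ j) →
      lam ≤ (s : ℝ) ^ i * (m : ℝ) ^ j * (p : ℝ) ^ ((i + j).choose 2 + j)) :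
    (SimpleGraph.binomialRandom (Fin n) p).real {G | ¬ G.NeighborsLinked (t + 3) (2 * s)} ≤
      (n : ℝ) ^ (2 * s + 1) * Real.exp (-(lam / 2 ^ (t + 5))) := by
  classical
  have hsub : {G : SimpleGraph (Fin n) | ¬ G.NeighborsLinked (t + 3) (2 * s)} ⊆
      ⋃ x ∈ (Finset.univ : Finset (Fin n)) ×ˢ
        (Finset.univ : Finset (Fin n)).powersetCard (2 * s),
        {G | (∀ a ∈ x.2, G.Adj x.1 a) ∧
          ¬ ∃ a ∈ x.2, ∃ b ∈ x.2, a ≠ b ∧ G.CliqueLinked (t + 3) x.1 a b} := by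
    intro G hG
    simp only [SimpleGraph.NeighborsLinked, Set.mem_ofPred_eq] at hG
    push Not at hG
    obtain ⟨v, A, hA, hadj, hno⟩ := hG
    simp only [Set.mem_iUnion]
    refine ⟨(v, A), by simp [hA], hadj, ?_⟩
    push Not
    exact hno
  refine (MeasureTheory.measureReal_mono hsub (MeasureTheory.measure_ne_top _ _)).trans
    ((MeasureTheory.measureReal_biUnion_finset_le _ _).trans ?_)
  refine (Finset.sum_le_sum fun x hx => binomialRandom_not_linked_le hp hlam hm h x.1 x.2
    (Finset.mem_powersetCard.1 (Finset.mem_product.1 hx).2).2).trans ?_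
  rw [Finset.sum_const, nsmul_eq_mul, Finset.card_product, Finset.card_powersetCard,
    Finset.card_univ, Fintype.card_fin]
  refine mul_le_mul_of_nonneg_right ?_ (Real.exp_nonneg _)
  have : n * n.choose (2 * s) ≤ n ^ (2 * s + 1) := by
    rw [pow_succ, mul_comm]
    exact Nat.mul_le_mul_right _ (Nat.choose_le_pow _ _)
  exact_mod_cast this

/-- Markov's inequality for 2^e(G), whose mean is a product of factors 1 + p, each at most exp p. -/
lemma binomialRandom_lt_numTransitiveOrientations_le (p : unitInterval) {a : ℝ} (ha : 0 < a) (r : ℕ) :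
    (SimpleGraph.binomialRandom (Fin n) p).real
      {G | a < (G.numTransitiveOrientations r : ℝ)} ≤ Real.exp ((p : ℝ) * n ^ 2) / a := by
  classical
  have hp0 : (0 : ℝ) ≤ p := p.2.1
  have hp1 : (p : ℝ) ≤ 1 := p.2.2
  rw [binomialRandom_real_eq_bernExp]
  have h1 : bernExp (edgeProb (Fin n) p) (fun S => a⁻¹ * 2 ^ S.card) ≤
      Real.exp ((p : ℝ) * n ^ 2) / a := by
    rw [bernExp_const_mul, bernExp_two_pow_card, div_eq_inv_mul]
    refine mul_le_mul_of_nonneg_left ?_ (inv_pos.2 ha).le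
    calc ∏ e : Sym2 (Fin n), (1 + edgeProb (Fin n) p e)
        ≤ ∏ e : Sym2 (Fin n), Real.exp p := by
          refine Finset.prod_le_prod (fun e _ => ?_) fun e _ => ?_
          · have := edgeProb_nonneg hp0 e; linarith
          · refine le_trans ?_ (Real.add_one_le_exp _)
            unfold edgeProb; split_ifs <;> linarith
      _ = Real.exp ((p : ℝ) * Fintype.card (Sym2 (Fin n))) := by
          rw [Finset.prod_const, ← Real.exp_nat_mul, Finset.card_univ, mul_comm]
      _ ≤ _ := by
          refine Real.exp_le_exp.2 (mul_le_mul_of_nonneg_left ?_ hp0)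
          have : Fintype.card (Sym2 (Fin n)) ≤ n ^ 2 := by
            have := Fintype.card_le_of_surjective (fun x : Fin n × Fin n => s(x.1, x.2))
              (fun e => by induction e using Sym2.ind with | _ x y => exact ⟨(x, y), rfl⟩)
            simpa [sq] using this
          exact_mod_cast this
  refine le_trans (bernExp_mono (edgeProb_nonneg hp0) (edgeProb_le_one hp1) fun S => ?_) h1
  split_ifs with hS
  · rw [Set.mem_ofPred_eq] at hS
    have h2 := (SimpleGraph.fromEdgeSet (S : Set (Sym2 (Fin n)))).numTransitiveOrientations_le_two_pow
      (r := r)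
    have h3 : (SimpleGraph.fromEdgeSet (S : Set (Sym2 (Fin n)))).edgeFinset.card ≤ S.card := by
      refine Finset.card_le_card fun e he => ?_
      rw [SimpleGraph.mem_edgeFinset, SimpleGraph.edgeSet_fromEdgeSet] at he
      exact he.1
    have h4 : (((SimpleGraph.fromEdgeSet (S : Set (Sym2 (Fin n)))).numTransitiveOrientations r :
        ℕ) : ℝ) ≤ 2 ^ S.card := by
      exact_mod_cast h2.trans (Nat.pow_le_pow_right two_pos h3)
    rw [← div_eq_inv_mul, le_div_iff₀ ha, one_mul]
    exact hS.le.trans h4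
  · positivity

end NeighborsLinked

/-! ### Expected counts of sub-patterns -/

/-- The expected number of ways, capped at one, to extend a triangle of the binomial random graph to
a clique by `t` further vertices, up to a constant factor. -/
noncomputable def extensionRate (n t : ℕ) (p : ℝ) : ℝ :=
  min 1 (((n : ℝ) * √p ^ (t + 5)) ^ t)

section Numerics

variable {n t : ℕ} {p : ℝ}

lemma extensionRate_le_one : extensionRate n t p ≤ 1 := min_le_left _ _

lemma extensionRate_pos (hn : 0 < n) (hp : 0 < p) : 0 < extensionRate n t p := by
  have : 0 < √p := Real.sqrt_pos.2 hp
  exact lt_min one_pos (by positivity)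

lemma extensionRate_le_pow (hp1 : p ≤ 1) {j : ℕ} (hj : j ≤ t) :
    extensionRate n t p ≤ ((n : ℝ) * √p ^ (j + 5)) ^ j := by
  have hx0 := Real.sqrt_nonneg p
  have hx1 : √p ≤ 1 := Real.sqrt_le_one.2 hp1
  have hle : (n : ℝ) * √p ^ (t + 5) ≤ (n : ℝ) * √p ^ (j + 5) :=
    mul_le_mul_of_nonneg_left (pow_le_pow_of_le_one hx0 hx1 (by omega)) (Nat.cast_nonneg n)
  have h0 : 0 ≤ (n : ℝ) * √p ^ (t + 5) := by positivity
  rcases le_total 1 ((n : ℝ) * √p ^ (t + 5)) with h | h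
  · exact extensionRate_le_one.trans (one_le_pow₀ (h.trans hle))
  · exact (min_le_right _ _).trans ((pow_le_pow_of_le_one h0 h hj).trans
      (pow_le_pow_left₀ h0 hle j))

lemma sqrt_pow_two_mul (hp : 0 ≤ p) (k : ℕ) : √p ^ (2 * k) = p ^ k := by
  rw [pow_mul, Real.sq_sqrt hp]

lemma two_mul_choose_two (k : ℕ) : 2 * k.choose 2 = k * (k - 1) := by
  rw [Nat.choose_two_right, Nat.mul_div_cancel' (Nat.even_mul_pred_self k).two_dvd]

/-- Counting exponents, n p² q ≤ (n √p^(t+4))^(t+1), so n √p^(t+4) ≥ 1, whence (n √p^(t+3))^(t+4) ≥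
n. A lower bound of 1 thus becomes a power of n, which absorbs logarithms. -/
lemma le_mul_sqrt_pow (hn : 0 < n) (hp0 : 0 < p) {Y : ℝ} (hY : Y ^ (t + 4) ≤ n)
    (h : 1 ≤ (n : ℝ) * p ^ 2 * extensionRate n t p) : Y ≤ (n : ℝ) * √p ^ (t + 3) := by
  have hx0 : 0 < √p := Real.sqrt_pos.2 hp0
  have hn0 : (0 : ℝ) < n := Nat.cast_pos.2 hn
  have h1 : 1 ≤ ((n : ℝ) * √p ^ (t + 4)) ^ (t + 1) := by
    refine h.trans ((mul_le_mul_of_nonneg_left (min_le_right _ _) (by positivity)).trans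
      (le_of_eq ?_))
    rw [← sqrt_pow_two_mul hp0.le]
    ring
  have h2 : 1 ≤ (n : ℝ) * √p ^ (t + 4) := by
    by_contra! hlt
    exact absurd h1 (not_le.2 (pow_lt_one₀ (by positivity) hlt (by omega)))
  have h3 : (n : ℝ) ≤ ((n : ℝ) * √p ^ (t + 3)) ^ (t + 4) := by
    have : ((n : ℝ) * √p ^ (t + 3)) ^ (t + 4) = n * ((n : ℝ) * √p ^ (t + 4)) ^ (t + 3) := by ring
    rw [this]
    exact le_mul_of_one_le_right hn0.le (one_le_pow₀ h2)
  exact le_of_pow_le_pow_left₀ (by omega) (by positivity) (hY.trans h3)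

/-- All sub-patterns of the rooted clique with an edge have many expected copies. -/
lemma expected_subpattern_ge {s m : ℕ} {b K L : ℝ} (hp0 : 0 < p) (hp1 : p ≤ 1) (hb : 1 ≤ b)
    (hK : 1 ≤ K * L) (hmb : (n : ℝ) ≤ b * m)
    (hs : K * b ^ t * L ≤ s * (p * extensionRate n t p))
    (hsn : K * s * L ≤ m * p) (hx : K * L ≤ m * √p ^ (t + 3))
    {i j : ℕ} (hi : i ≤ 2) (hj : j ≤ t) (hij : 2 ≤ i ∨ 1 ≤ j) :
    K * s * L ≤ (s : ℝ) ^ i * (m : ℝ) ^ j * p ^ ((i + j).choose 2 + j) := by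
  have hx0 : 0 < √p := Real.sqrt_pos.2 hp0
  have hx1 : √p ≤ 1 := Real.sqrt_le_one.2 hp1
  have hpow : ∀ a k : ℕ, 2 * a = k → p ^ a = √p ^ k := fun a k h => by
    rw [← h, sqrt_pow_two_mul hp0.le]
  have hdec : ∀ k, k ≤ t + 3 → K * L ≤ m * √p ^ k := fun k hk =>
    hx.trans (mul_le_mul_of_nonneg_left (pow_le_pow_of_le_one hx0.le hx1 hk) (by positivity))
  have hch : ∀ k, 2 * (k + 1).choose 2 = (k + 1) * k := fun k => by
    rw [two_mul_choose_two]; rfl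
  interval_cases i
  -- No marked vertex: with j = k + 1 the count is m p (m √p^(k+3))^k, and m p alone suffices.
  · obtain ⟨k, rfl⟩ : ∃ k, j = k + 1 := ⟨j - 1, by omega⟩
    rw [hpow _ (2 + k * (k + 3)) (by rw [mul_add, zero_add, hch]; ring)]
    have h1 : 1 ≤ ((m : ℝ) * √p ^ (k + 3)) ^ k := one_le_pow₀ (hK.trans (hdec _ (by omega)))
    have e : (s : ℝ) ^ 0 * (m : ℝ) ^ (k + 1) * √p ^ (2 + k * (k + 3)) =
        m * p * ((m : ℝ) * √p ^ (k + 3)) ^ k := by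
      rw [show p = √p ^ 2 from (Real.sq_sqrt hp0.le).symm, Real.sqrt_sq hx0.le]; ring
    rw [e]
    exact hsn.trans (le_mul_of_one_le_right (by positivity) h1)
  -- One marked vertex: the count is s (m √p^(j+3))^j, where j ≥ 1.
  · rw [hpow _ (j * (j + 3)) (by rw [mul_add, add_comm 1 j, hch]; ring)]
    have h1 : K * L ≤ ((m : ℝ) * √p ^ (j + 3)) ^ j := by
      have h := hdec (j + 3) (by omega)
      exact h.trans (le_self_pow₀ (hK.trans h) (by omega))
    calc K * s * L = s * (K * L) := by ring
      _ ≤ s * ((m : ℝ) * √p ^ (j + 3)) ^ j := mul_le_mul_of_nonneg_left h1 (by positivity)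
      _ = _ := by ring
  -- Two marked vertices: the count is s² p (m √p^(j+5))^j. Here the size of s is forced, through s
  -- p q being at least of order L.
  · rw [hpow _ (2 + j * (j + 5)) (by rw [mul_add, add_comm 2 j, hch]; ring)]
    have h1 : extensionRate n t p ≤ b ^ t * ((m : ℝ) * √p ^ (j + 5)) ^ j := by
      refine (extensionRate_le_pow hp1 hj).trans ?_
      calc ((n : ℝ) * √p ^ (j + 5)) ^ j ≤ (b * m * √p ^ (j + 5)) ^ j := by gcongr
        _ = b ^ j * ((m : ℝ) * √p ^ (j + 5)) ^ j := by ring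
        _ ≤ _ := mul_le_mul_of_nonneg_right (pow_le_pow_right₀ hb hj) (by positivity)
    have h2 : K * b ^ t * L ≤ b ^ t * (s * p * ((m : ℝ) * √p ^ (j + 5)) ^ j) := by
      refine hs.trans ((mul_le_mul_of_nonneg_left (mul_le_mul_of_nonneg_left h1 hp0.le)
        (Nat.cast_nonneg s)).trans (le_of_eq (by ring)))
    have h3 : K * L ≤ s * p * ((m : ℝ) * √p ^ (j + 5)) ^ j := by
      refine le_of_mul_le_mul_left (le_trans (le_of_eq ?_) h2) (by positivity : 0 < b ^ t)
      ring
    calc K * s * L = s * (K * L) := by ring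
      _ ≤ s * (s * p * ((m : ℝ) * √p ^ (j + 5)) ^ j) :=
          mul_le_mul_of_nonneg_left h3 (by positivity)
      _ = _ := by
          nth_rewrite 1 [show p = √p ^ 2 from (Real.sq_sqrt hp0.le).symm]; ring

end Numerics

/-! ### The sparse and dense cases, and the common bound -/

section Main

variable {n t : ℕ} {p : unitInterval}

lemma binomialRandom_exp_lt_of_sparse {C K : ℝ} (hp : 0 < (p : ℝ)) (hn : 3 ≤ n)
    (hC : K + 1 ≤ C) (hsparse : (n : ℝ) * p ^ 2 * extensionRate n t p ≤ K * Real.log n ^ 2) :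
    (SimpleGraph.binomialRandom (Fin n) p).real {G | Real.exp (C * (n * Real.log n ^ 2) /
      (p * extensionRate n t p)) < (G.numTransitiveOrientations (t + 3) : ℝ)} ≤ 1 / n := by
  have hn0 : (0 : ℝ) < n := by positivity
  have hL : 1 ≤ Real.log n := by
    rw [Real.le_log_iff_exp_le hn0]
    exact Real.exp_one_lt_three.le.trans (by exact_mod_cast hn)
  have hq := extensionRate_pos (t := t) (by omega : 0 < n) hp
  have hq1 := extensionRate_le_one (n := n) (t := t) (p := p)
  have hp1 : (p : ℝ) ≤ 1 := p.2.2
  have hpq : 0 < (p : ℝ) * extensionRate n t p := mul_pos hp hq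
  have hpq1 : (p : ℝ) * extensionRate n t p ≤ 1 := mul_le_one₀ hp1 hq.le hq1
  have hexp : (p : ℝ) * n ^ 2 + Real.log n ≤
      C * (n * Real.log n ^ 2) / (p * extensionRate n t p) := by
    rw [le_div_iff₀ hpq]
    have h1 : (p : ℝ) * n ^ 2 * (p * extensionRate n t p) ≤ n * (K * Real.log n ^ 2) := by
      have := mul_le_mul_of_nonneg_left hsparse hn0.le
      linarith [this]
    have h2 : Real.log n * (p * extensionRate n t p) ≤ n * Real.log n ^ 2 := by
      have hn1 : (1 : ℝ) ≤ n := by exact_mod_cast (by omega : 1 ≤ n)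
      calc Real.log n * (p * extensionRate n t p) ≤ Real.log n * 1 := by gcongr
        _ ≤ 1 * Real.log n ^ 2 := by nlinarith
        _ ≤ _ := by gcongr
    have h3 : (K + 1) * (n * Real.log n ^ 2) ≤ C * (n * Real.log n ^ 2) :=
      mul_le_mul_of_nonneg_right hC (by positivity)
    linarith
  have key := binomialRandom_lt_numTransitiveOrientations_le (n := n) p
    (Real.exp_pos (C * (n * Real.log n ^ 2) / (p * extensionRate n t p))) (t + 3)
  refine key.trans ?_
  rw [← Real.exp_sub, one_div, ← Real.exp_log (inv_pos.2 hn0), Real.log_inv]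
  exact Real.exp_le_exp.2 (by linarith)

lemma SimpleGraph.NeighborsLinked.numTransitiveOrientations_le_exp {r s : ℕ}
    {G : SimpleGraph (Fin n)} (hn : 3 ≤ n) (hG : G.NeighborsLinked r (2 * s)) :
    (G.numTransitiveOrientations r : ℝ) ≤ Real.exp (4 * s * n * Real.log n) := by
  have hn0 : (0 : ℝ) < n := by positivity
  have h1 : n + 1 ≤ n ^ 2 := by nlinarith
  have h2 : G.numTransitiveOrientations r ≤ n ^ (4 * s * n) := by
    refine hG.numTransitiveOrientations_le.trans ?_
    calc ((n + 1) ^ (2 * s)) ^ n ≤ ((n ^ 2) ^ (2 * s)) ^ n := by gcongr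
      _ = n ^ (4 * s * n) := by rw [← pow_mul, ← pow_mul]; ring_nf
  calc (G.numTransitiveOrientations r : ℝ) ≤ (n : ℝ) ^ (4 * s * n) := by exact_mod_cast h2
    _ = Real.exp (4 * s * n * Real.log n) := by
      rw [← Real.exp_log (pow_pos hn0 _), Real.log_pow]; push_cast; ring_nf

lemma binomialRandom_exp_lt_of_dense (ht : 1 ≤ t) {C b K C₀ : ℝ} (hp : 0 < (p : ℝ)) (hn : 3 ≤ n)
    (hb : b = 8 * t) (hK : K = 2 ^ (t + 7)) (hC₀ : C₀ = K * b ^ t) (hC : 8 * C₀ ≤ C)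
    (hnt : 8 * t ≤ n) (hlog : (b * K * Real.log n) ^ (t + 4) ≤ n)
    (hdense : 2 * b * K * C₀ * Real.log n ^ 2 ≤ (n : ℝ) * p ^ 2 * extensionRate n t p) :
    (SimpleGraph.binomialRandom (Fin n) p).real {G | Real.exp (C * (n * Real.log n ^ 2) /
      (p * extensionRate n t p)) < (G.numTransitiveOrientations (t + 3) : ℝ)} ≤ 1 / n := by
  have hn0 : (0 : ℝ) < n := by positivity
  have ht1 : (1 : ℝ) ≤ t := by exact_mod_cast ht
  have hL : 1 ≤ Real.log n := by
    rw [Real.le_log_iff_exp_le hn0]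
    exact Real.exp_one_lt_three.le.trans (by exact_mod_cast hn)
  have hp1 : (p : ℝ) ≤ 1 := p.2.2
  have hq := extensionRate_pos (t := t) (by omega : 0 < n) hp
  have hq1 := extensionRate_le_one (n := n) (t := t) (p := p)
  have hpq : 0 < (p : ℝ) * extensionRate n t p := mul_pos hp hq
  have hpq1 : (p : ℝ) * extensionRate n t p ≤ 1 := mul_le_one₀ hp1 hq.le hq1
  have hb1 : 8 ≤ b := by rw [hb]; linarith
  have hK1 : 128 ≤ K := by
    rw [hK, pow_add]
    have : (1 : ℝ) ≤ 2 ^ t := one_le_pow₀ (by norm_num)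
    linarith
  have hC₀1 : 1 ≤ C₀ := by
    rw [hC₀]
    exact one_le_mul_of_one_le_of_one_le (by linarith) (one_le_pow₀ (by linarith))
  set L := Real.log n with hLdef
  set q := extensionRate n t p with hqdef
  -- The least order of s for which two marked vertices have enough extensions; rounding up at most
  -- doubles it, as the quotient is at least 1.
  set s : ℕ := ⌈C₀ * L / (p * q)⌉₊ with hs
  -- The t blocks use at most n/4 vertices, leaving room for A and v, while n ≤ 8 t m.
  set m : ℕ := n / (4 * t) with hm
  have hsL : C₀ * L / (p * q) ≤ s := Nat.le_ceil _
  have h1le : 1 ≤ C₀ * L / (p * q) := by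
    rw [le_div_iff₀ hpq, one_mul]
    exact hpq1.trans (one_le_mul_of_one_le_of_one_le hC₀1 hL)
  have hsU : (s : ℝ) ≤ 2 * (C₀ * L / (p * q)) := by
    have := (Nat.ceil_lt_add_one (zero_le_one.trans h1le)).le
    linarith
  have hs1 : (1 : ℝ) ≤ s := h1le.trans hsL
  have hmb : (n : ℝ) ≤ b * m := by
    have h1 : n < 4 * t * (m + 1) := by
      rw [hm]; exact Nat.lt_mul_div_succ n (by omega)
    have hm1 : 1 ≤ m := by rw [hm, Nat.le_div_iff_mul_le (by omega)]; omega
    have h2 : n ≤ 8 * t * m := by nlinarith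
    rw [hb]; exact_mod_cast h2
  have hsn : K * s * L ≤ m * p := by
    have h1 : b * (K * s * L) ≤ b * (m * p) := by
      calc b * (K * s * L) ≤ b * (K * (2 * (C₀ * L / (p * q))) * L) := by gcongr
        _ = 2 * b * K * C₀ * L ^ 2 / (p * q) := by ring
        _ ≤ n * p := by rw [div_le_iff₀ hpq]; linarith
        _ ≤ b * m * p := by gcongr
        _ = b * (m * p) := by ring
    exact le_of_mul_le_mul_left h1 (by linarith)
  have hmn : 4 * (t * m) ≤ n := by
    calc 4 * (t * m) = 4 * t * m := by ring
      _ ≤ n := Nat.mul_div_le n (4 * t)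
  have hsm : 128 * s ≤ m := by
    have : (128 : ℝ) * s ≤ m := by
      calc (128 : ℝ) * s ≤ K * s * L := by
            have : (128 : ℝ) * s ≤ K * s := by gcongr
            exact this.trans (le_mul_of_one_le_right (by positivity) hL)
        _ ≤ m * p := hsn
        _ ≤ m := mul_le_of_le_one_right (by positivity) hp1
    exact_mod_cast this
  have hmt : m ≤ t * m := Nat.le_mul_of_pos_left m (by omega)
  have hone : 1 ≤ (n : ℝ) * (p : ℝ) ^ 2 * q := by
    refine le_trans ?_ hdense
    have h1 : (1 : ℝ) ≤ 2 * b * K * C₀ := by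
      refine one_le_mul_of_one_le_of_one_le (one_le_mul_of_one_le_of_one_le ?_ ?_) hC₀1 <;>
      linarith
    exact one_le_mul_of_one_le_of_one_le h1 (one_le_pow₀ hL)
  have hx : K * L ≤ m * √(p : ℝ) ^ (t + 3) := by
    have h1 := le_mul_sqrt_pow (by omega : 0 < n) hp hlog hone
    have h2 : b * (K * L) ≤ b * (m * √(p : ℝ) ^ (t + 3)) := by
      calc b * (K * L) = b * K * L := by ring
        _ ≤ n * √(p : ℝ) ^ (t + 3) := h1
        _ ≤ b * m * √(p : ℝ) ^ (t + 3) := by gcongr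
        _ = _ := by ring
    exact le_of_mul_le_mul_left h2 (by linarith)
  have hsC : K * b ^ t * L ≤ s * (p * q) := by
    rw [← hC₀]; exact (div_le_iff₀ hpq).1 hsL
  have hs1' : 1 ≤ s := by exact_mod_cast hs1
  have key := binomialRandom_not_neighborsLinked_le (p := p) (n := n) (t := t) (s := s) (m := m)
    (lam := K * s * L) hp (by positivity) (by omega) fun i j hi hj hij =>
      expected_subpattern_ge hp hp1 (by linarith)
        (one_le_mul_of_one_le_of_one_le (by linarith) hL) hmb hsC hsn hx hi hj hij
  refine (MeasureTheory.measureReal_mono (fun G hG hlink => ?_)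
    (MeasureTheory.measure_ne_top _ _)).trans (key.trans ?_)
  · refine absurd (hlink.numTransitiveOrientations_le_exp hn)
      (not_le.2 (lt_of_le_of_lt (Real.exp_le_exp.2 ?_) hG))
    calc 4 * (s : ℝ) * n * L ≤ 4 * (2 * (C₀ * L / (p * q))) * n * L := by gcongr
      _ = 8 * C₀ * (n * L ^ 2) / (p * q) := by ring
      _ ≤ C * (n * L ^ 2) / (p * q) := by gcongr
  -- The value K = 2^(t+7) makes the Janson exponent exactly 4 s L against (2s + 1) L from the union
  -- bound; s ≥ 1 leaves a surplus of at least L.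
  · have h1 : (n : ℝ) ^ (2 * s + 1) = Real.exp ((2 * s + 1) * L) := by
      rw [← Real.exp_log (pow_pos hn0 _), Real.log_pow]; push_cast; rfl
    have h2 : K * s * L / 2 ^ (t + 5) = 4 * s * L := by
      rw [hK, show t + 7 = (t + 5) + 2 by ring, pow_add _ (t + 5) 2]; field_simp; norm_num
    rw [h1, h2, ← Real.exp_add, one_div, ← Real.exp_log (inv_pos.2 hn0), Real.log_inv]
    exact Real.exp_le_exp.2 (by nlinarith)

/-- In the binomial random graph, at all densities, the number of orientations in which every
`K_{t+3}` is transitive is at most `exp (C n (log n)² / (p q))`, where `q` is the capped expected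
number of extensions of a triangle to a `K_{t+3}`. -/
theorem exists_binomialRandom_exp_lt_le (ht : 1 ≤ t) :
    ∃ C : ℝ, 0 < C ∧ ∀ᶠ n : ℕ in Filter.atTop, ∀ p : unitInterval, 0 < (p : ℝ) →
      (SimpleGraph.binomialRandom (Fin n) p).real {G | Real.exp (C * (n * Real.log n ^ 2) /
        (p * extensionRate n t p)) < (G.numTransitiveOrientations (t + 3) : ℝ)} ≤ 1 / n := by
  obtain ⟨b, hb⟩ : ∃ b : ℝ, b = 8 * t := ⟨_, rfl⟩
  obtain ⟨K, hK⟩ : ∃ K : ℝ, K = 2 ^ (t + 7) := ⟨_, rfl⟩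
  obtain ⟨C₀, hC₀⟩ : ∃ C₀ : ℝ, C₀ = K * b ^ t := ⟨_, rfl⟩
  have hb0 : 0 ≤ b := by rw [hb]; positivity
  have hK0 : 0 ≤ K := by rw [hK]; positivity
  have hC₀0 : 0 ≤ C₀ := by rw [hC₀]; positivity
  have hprod : 0 ≤ 2 * b * K * C₀ := by positivity
  -- The term 8 C₀ serves the dense case; the other two serve the sparse case, which starts below n
  -- p² q = 2 b K C₀ (log n)².
  refine ⟨8 * C₀ + 2 * b * K * C₀ + 1, by linarith, ?_⟩
  have hlog : ∀ᶠ n : ℕ in Filter.atTop, (b * K * Real.log n) ^ (t + 4) ≤ n := by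
    have h := ((Real.isLittleO_pow_log_id_atTop (n := t + 4)).const_mul_left
      ((b * K) ^ (t + 4))).bound one_pos
    filter_upwards [tendsto_natCast_atTop_atTop.eventually h] with n hn
    rw [one_mul, id, Real.norm_natCast] at hn
    rw [mul_pow]
    exact (le_abs_self _).trans hn
  filter_upwards [hlog, Filter.eventually_ge_atTop 3, Filter.eventually_ge_atTop (8 * t)]
    with n h1 h2 h3 p hp
  rcases le_total ((n : ℝ) * p ^ 2 * extensionRate n t p) (2 * b * K * C₀ * Real.log n ^ 2)
    with h | h
  · exact binomialRandom_exp_lt_of_sparse hp h2 (by linarith) h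
  · exact binomialRandom_exp_lt_of_dense ht hp h2 hb hK hC₀ (by linarith) h3 h1 h

lemma tendsto_binomialRandom_one {p : ℕ → unitInterval} {r : ℕ} {B : ℕ → ℝ}
    (h : ∀ᶠ n : ℕ in Filter.atTop, (SimpleGraph.binomialRandom (Fin n) (p n)).real
      {G | B n < (G.numTransitiveOrientations r : ℝ)} ≤ 1 / n) :
    Filter.Tendsto (fun n : ℕ => SimpleGraph.binomialRandom (Fin n) (p n)
      {G : SimpleGraph (Fin n) | (G.numTransitiveOrientations r : ℝ) ≤ B n})
      Filter.atTop (nhds 1) := by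
  have hreal : Filter.Tendsto (fun n : ℕ => (SimpleGraph.binomialRandom (Fin n) (p n)).real
      {G : SimpleGraph (Fin n) | (G.numTransitiveOrientations r : ℝ) ≤ B n})
      Filter.atTop (nhds 1) := by
    have hl : Filter.Tendsto (fun n : ℕ => 1 - 1 / (n : ℝ)) Filter.atTop (nhds 1) := by
      simpa using tendsto_one_div_atTop_nhds_zero_nat.const_sub (1 : ℝ)
    refine tendsto_of_tendsto_of_tendsto_of_le_of_le' hl tendsto_const_nhds ?_
      (Filter.Eventually.of_forall fun n => MeasureTheory.measureReal_le_one)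
    filter_upwards [h] with n hn
    have hU := MeasureTheory.measureReal_union_le (μ := SimpleGraph.binomialRandom (Fin n) (p n))
      {G : SimpleGraph (Fin n) | (G.numTransitiveOrientations r : ℝ) ≤ B n}
      {G : SimpleGraph (Fin n) | B n < (G.numTransitiveOrientations r : ℝ)}
    have huniv : {G : SimpleGraph (Fin n) | (G.numTransitiveOrientations r : ℝ) ≤ B n} ∪
        {G : SimpleGraph (Fin n) | B n < (G.numTransitiveOrientations r : ℝ)} = Set.univ := by
      ext G; simpa using le_or_gt _ _
    rw [huniv, MeasureTheory.probReal_univ] at hU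
    linarith
  have := ENNReal.tendsto_ofReal hreal
  simpa [MeasureTheory.ofReal_measureReal] using this

lemma one_lt_natCast_mul_sqrt_pow_iff (hn : 0 < n) {p : ℝ} (hp : 0 ≤ p) :
    1 < (n : ℝ) * √p ^ (t + 5) ↔ (n : ℝ) ^ (-(2 : ℝ) / ((t + 3 : ℕ) + 2)) < p := by
  have hn0 : (0 : ℝ) < n := Nat.cast_pos.2 hn
  have ht : (0 : ℝ) < ((t + 3 : ℕ) : ℝ) + 2 := by positivity
  have e1 : √p ^ (t + 5) = p ^ ((((t + 3 : ℕ) : ℝ) + 2) / 2) := by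
    rw [Real.sqrt_eq_rpow, ← Real.rpow_natCast, ← Real.rpow_mul hp]
    congr 1; push_cast; ring
  have e2 : ((n : ℝ) ^ (-(2 : ℝ) / ((t + 3 : ℕ) + 2))) ^ ((((t + 3 : ℕ) : ℝ) + 2) / 2) =
      (n : ℝ)⁻¹ := by
    rw [← Real.rpow_mul hn0.le, ← Real.rpow_neg_one]
    congr 1; field_simp
  rw [← Real.rpow_lt_rpow_iff (by positivity) hp (by positivity : 0 < (((t + 3 : ℕ) : ℝ) + 2) / 2),
    e1, e2, inv_lt_iff_one_lt_mul₀ hn0, mul_comm]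

/-- The exponents match because C(t+3, 2) - 2 = 1 + t(t+5)/2 and 4 - r = 1 - t. -/
lemma sparse_exponent_eq (hn : 0 < n) {p : ℝ} (hp : 0 < p) (A B : ℝ) :
    A * (n * B) / (p * ((n : ℝ) * √p ^ (t + 5)) ^ t) =
      A * ((n : ℝ) ^ (4 - ((t + 3 : ℕ) : ℤ)) * B) / p ^ ((t + 3).choose 2 - 2) := by
  have hn0 : (n : ℝ) ≠ 0 := (Nat.cast_pos.2 hn).ne'
  have hch : 2 * ((t + 3).choose 2 - 2) = 2 + t * (t + 5) := by
    have h := two_mul_choose_two (t + 3)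
    have h' : (t + 3) * (t + 3 - 1) = t * (t + 5) + 6 := by
      rw [show t + 3 - 1 = t + 2 from rfl]; ring
    omega
  have e1 : p ^ ((t + 3).choose 2 - 2) = p * √p ^ (t * (t + 5)) := by
    rw [← sqrt_pow_two_mul hp.le, hch, pow_add, Real.sq_sqrt hp.le]
  have e2 : (n : ℝ) ^ (4 - ((t + 3 : ℕ) : ℤ)) = n / n ^ t := by
    rw [show (4 : ℤ) - ((t + 3 : ℕ) : ℤ) = 1 - (t : ℤ) by push_cast; ring, zpow_sub₀ hn0,
      zpow_one, zpow_natCast]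
  have hx : √p ≠ 0 := (Real.sqrt_pos.2 hp).ne'
  rw [e1, e2, mul_pow, ← pow_mul, mul_comm (t + 5) t]
  field_simp

end Main

theorem mainTheorem8 (r : ℕ) (hr : 4 ≤ r) :
    (∃ C : ℝ, 0 < C ∧ ∀ p : ℕ → unitInterval,
      (∀ᶠ n : ℕ in Filter.atTop, (n : ℝ) ^ (-(2 : ℝ) / ((r : ℝ) + 2)) < (p n : ℝ)) →
      Filter.Tendsto
        (fun n : ℕ => SimpleGraph.binomialRandom (Fin n) (p n)
          {G : SimpleGraph (Fin n) | (G.numTransitiveOrientations r : ℝ) ≤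
            Real.exp (C * ((n : ℝ) * Real.log (n : ℝ) ^ 2) / (p n : ℝ))})
        Filter.atTop (nhds 1)) ∧
    (∃ C : ℝ, 0 < C ∧ ∀ p : ℕ → unitInterval,
      (∀ᶠ n : ℕ in Filter.atTop,
        0 < (p n : ℝ) ∧ (p n : ℝ) ≤ (n : ℝ) ^ (-(2 : ℝ) / ((r : ℝ) + 2))) →
      Filter.Tendsto
        (fun n : ℕ => SimpleGraph.binomialRandom (Fin n) (p n)
          {G : SimpleGraph (Fin n) | (G.numTransitiveOrientations r : ℝ) ≤
            Real.exp (C * ((n : ℝ) ^ (4 - (r : ℤ)) * Real.log (n : ℝ) ^ 2) /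
              (p n : ℝ) ^ (r.choose 2 - 2))})
        Filter.atTop (nhds 1)) := by
  obtain ⟨t, rfl⟩ : ∃ t, r = t + 3 := ⟨r - 3, by omega⟩
  obtain ⟨C, hC, h⟩ := exists_binomialRandom_exp_lt_le (t := t) (by omega)
  refine ⟨⟨C, hC, fun p hp => tendsto_binomialRandom_one ?_⟩,
    ⟨C, hC, fun p hp => tendsto_binomialRandom_one ?_⟩⟩
  · filter_upwards [h, hp, Filter.eventually_gt_atTop 0] with n h1 h2 h3
    have hp0 : 0 < (p n : ℝ) := lt_of_le_of_lt (by positivity) h2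
    have := h1 (p n) hp0
    have hq : extensionRate n t (p n) = 1 := min_eq_left
      (one_le_pow₀ ((one_lt_natCast_mul_sqrt_pow_iff h3 hp0.le).2 h2).le)
    rwa [hq, mul_one] at this
  · filter_upwards [h, hp, Filter.eventually_gt_atTop 0] with n h1 h2 h3
    have := h1 (p n) h2.1
    have hle : (n : ℝ) * √(p n : ℝ) ^ (t + 5) ≤ 1 :=
      not_lt.1 fun hlt => not_lt.2 h2.2 ((one_lt_natCast_mul_sqrt_pow_iff h3 h2.1.le).1 hlt)
    have hq : extensionRate n t (p n) = ((n : ℝ) * √(p n : ℝ) ^ (t + 5)) ^ t :=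
      min_eq_right (pow_le_one₀ (by positivity) hle)
    rwa [hq, sparse_exponent_eq h3 h2.1] at this
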